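/- Let $n\ge 1$ and consider a deck of $2n$ cards. A horseshoe shuffle cuts the deck into its top and bottom halves of $n$ cards each, reverses the order of the bottom half, and then perfectly interlaces the two halves. In the out horseshoe shuffle the top card stays on top, so that the deck $0,1,\dots,2n-1$ (listed from the top) becomes $0,\,2n-1,\,1,\,2n-2,\,\dots,\,n-1,\,n$; in the in horseshoe shuffle the top card moves to the second position, so that the deck becomes $2n-1,\,0,\,2n-2,\,1,\,\dots,\,n,\,n-1$. Let $\mathrm{Horse}(2n)$ be the group of permutations of the $2n$ positions generated by the in and out horseshoe shuffles. Then \[ |\mathrm{Horse}(2n)|=\begin{cases} 4\cdot5\cdot6=120 & \text{if } 2n=6,\\ 8\cdot9\cdot10\cdot11\cdot12=95040 & \text{if } 2n=12,\\ (k+1)2^k & \text{if } 2n=2^k \text{ with } k\ge 2,\\ (2n)! & \text{if } n \text{ is odd and } n\ne 3,\\ (2n)!/2 & \text{if } n \text{ is even, } n\ne 6 \text{ and } n \text{ is not a power of } 2. \end{cases} \] Moreover, $|\mathrm{Horse}(2n)|$ is the number of arrangements of the deck that can be reached from the initial one by finitely many in and out horseshoe shuffles. -/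

import Mathlib

open scoped Nat

/-- The out horseshoe shuffle of a deck of `2n` cards, as the permutation of the positions
`0, 1, …, 2n - 1` (counted from the top) that sends the old position of each card to its new one.
The deck is cut into two halves, the order of the bottom half is reversed, and the two halves are
interlaced with the top card staying on top: the top half goes to the positions `0, 2, 4, …` and
the reversed bottom half goes to the positions `1, 3, 5, …`.  The deck `0, 1, …, 2n - 1` becomes
`0, 2n - 1, 1, 2n - 2, …, n - 1, n`. -/
def outHorseshoe (n : ℕ) : Equiv.Perm (Fin (2 * n)) where
  toFun i := ⟨if (i : ℕ) < n then 2 * i else 2 * (2 * n - 1 - i) + 1, by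
    have := i.isLt; split_ifs <;> omega⟩
  invFun j := ⟨if (j : ℕ) % 2 = 0 then j / 2 else 2 * n - 1 - j / 2, by
    have := j.isLt; split_ifs <;> omega⟩
  left_inv i := by
    have := i.isLt; ext; dsimp only; split_ifs <;> omega
  right_inv j := by
    have := j.isLt; ext; dsimp only; split_ifs <;> omega

/-- The in horseshoe shuffle of a deck of `2n` cards, as the permutation of the positions
`0, 1, …, 2n - 1` that sends the old position of each card to its new one.
It differs from the out horseshoe shuffle in that the top card moves to the second position:
the top half goes to the positions `1, 3, 5, …` and the reversed bottom half goes to the positions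
`0, 2, 4, …`.  The deck `0, 1, …, 2n - 1` becomes `2n - 1, 0, 2n - 2, 1, …, n, n - 1`. -/
def inHorseshoe (n : ℕ) : Equiv.Perm (Fin (2 * n)) where
  toFun i := ⟨if (i : ℕ) < n then 2 * i + 1 else 2 * (2 * n - 1 - i), by
    have := i.isLt; split_ifs <;> omega⟩
  invFun j := ⟨if (j : ℕ) % 2 = 0 then 2 * n - 1 - j / 2 else j / 2, by
    have := j.isLt; split_ifs <;> omega⟩
  left_inv i := by
    have := i.isLt; ext; dsimp only; split_ifs <;> omega
  right_inv j := by
    have := j.isLt; ext; dsimp only; split_ifs <;> omega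

/-- The shuffle group `Horse(2n)`: the group of permutations of the positions of a deck of
`2n` cards that is generated by the in and the out horseshoe shuffle. -/
def Horse (n : ℕ) : Subgroup (Equiv.Perm (Fin (2 * n))) :=
  Subgroup.closure {inHorseshoe n, outHorseshoe n}

/-- The arrangements of a deck of `2n` cards that can be obtained from the deck
`0, 1, …, 2n - 1` by finitely many in and out horseshoe shuffles.  An arrangement `d` has the
card `d j` in position `j`; after a shuffle, position `j` holds the card that was in the position
which the shuffle sends to `j`. -/
inductive HorseArrangement (n : ℕ) : (Fin (2 * n) → Fin (2 * n)) → Prop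
  | start : HorseArrangement n id
  | shuffle_in (d : Fin (2 * n) → Fin (2 * n)) (h : HorseArrangement n d) :
      HorseArrangement n (d ∘ (inHorseshoe n).symm)
  | shuffle_out (d : Fin (2 * n) → Fin (2 * n)) (h : HorseArrangement n d) :
      HorseArrangement n (d ∘ (outHorseshoe n).symm)

/-! Write n = 2^a M with M odd. The two shuffles differ by the reversal of the deck, and conjugation
by the out shuffle runs along a chain of involutions: the block swaps of lengths M, 2M, …, n, then
the reversal, then the block swaps of lengths 1, 2, …, 2^a. So all of these lie in the group. If M =
1, the chain closes up and the group is small. If M ≥ 3, the conjugate of the swap of length 2^a is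
new, and the block swaps with their conjugates contain the alternating group, except for 6 and 12
cards (`alternatingGroup_le_shuffledSwapGroup`). The out shuffle is even and the in shuffle has sign
(-1)^n, which decides between the alternating and the symmetric group.

The alternating group is obtained by induction on a, through Jordan's theorem on primitive groups
with a three-cycle. Modulo reversal, the block swaps of 4n cards act on 2n classes as the block
swaps of 2n cards and their conjugates (`shuffledSwapGroup_le_foldSubgroup`). Hence three-cycles
lift, and the square of a lift moves only three pairs of mirror images; its conjugate by the out
shuffle moves only three pairs of adjacent cards. Two such elements whose supports meet in one card
have a three-cycle as commutator (`exists_cyclesTriple`). These cycles make every nontrivial block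
large; what remains is a two-colouring of the deck, excluded by `not_twoColouring`. The induction
starts from odd n ≥ 5, with an explicit three-cycle, and from 24 cards, by computation.

If 2n = 2^k, positions are bit vectors, the out shuffle is linear of order k + 1, and the in shuffle
is the out shuffle followed by a translation: the group is a semidirect product. For 6 and 12 cards
the group is sharply 3- and 5-transitive: words in the shuffles give transitivity, and an invariant
synthematic total or Steiner system S(5, 6, 12) shows that the pointwise stabilizer is trivial. -/

/-! ### Block swaps and the groups they generate. -/

/-- The involution of `ℕ` that swaps the two halves of every aligned block of length `2 * B`. -/
def blockSwap (B x : ℕ) : ℕ := if x % (2 * B) < B then x + B else x - B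

lemma blockSwap_mul_add {B r : ℕ} (q : ℕ) (hr : r < 2 * B) :
    blockSwap B (2 * B * q + r) = 2 * B * q + if r < B then r + B else r - B := by
  unfold blockSwap
  rw [Nat.mul_add_mod, Nat.mod_eq_of_lt hr]
  split_ifs <;> omega

lemma exists_eq_mul_add {B : ℕ} (hB : 0 < B) (x : ℕ) : ∃ q r, r < 2 * B ∧ x = 2 * B * q + r :=
  ⟨x / (2 * B), x % (2 * B), Nat.mod_lt _ (by omega), (Nat.div_add_mod _ _).symm⟩

lemma blockSwap_blockSwap {B : ℕ} (hB : 0 < B) (x : ℕ) : blockSwap B (blockSwap B x) = x := by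
  obtain ⟨q, r, hr, rfl⟩ := exists_eq_mul_add hB x
  rw [blockSwap_mul_add q hr, blockSwap_mul_add q (by split_ifs <;> omega)]
  split_ifs <;> omega

lemma blockSwap_two_mul {B : ℕ} (hB : 0 < B) (x : ℕ) :
    blockSwap (2 * B) (2 * x) = 2 * blockSwap B x := by
  obtain ⟨q, r, hr, rfl⟩ := exists_eq_mul_add hB x
  rw [blockSwap_mul_add q hr, show 2 * (2 * B * q + r) = 2 * (2 * B) * q + 2 * r by ring,
    blockSwap_mul_add q (by omega), mul_add, ← mul_assoc, ← mul_assoc, ← mul_assoc]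
  split_ifs <;> omega

lemma blockSwap_two_mul_add_one {B : ℕ} (hB : 0 < B) (x : ℕ) :
    blockSwap (2 * B) (2 * x + 1) = 2 * blockSwap B x + 1 := by
  obtain ⟨q, r, hr, rfl⟩ := exists_eq_mul_add hB x
  rw [blockSwap_mul_add q hr, show 2 * (2 * B * q + r) + 1 = 2 * (2 * B) * q + (2 * r + 1) by ring,
    blockSwap_mul_add q (by omega), mul_add, ← mul_assoc, ← mul_assoc, ← mul_assoc]
  split_ifs <;> omega

lemma blockSwap_lt {B K x : ℕ} (hB : 0 < B) (hK : 2 * B ∣ K) (hx : x < K) : blockSwap B x < K := by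
  obtain ⟨q, r, hr, rfl⟩ := exists_eq_mul_add hB x
  obtain ⟨m, rfl⟩ := hK
  have h1 : q < m := by
    by_contra h
    have := Nat.mul_le_mul_left (2 * B) (not_lt.1 h)
    omega
  have h2 : 2 * B * (q + 1) ≤ 2 * B * m := Nat.mul_le_mul_left _ h1
  rw [mul_add] at h2
  rw [blockSwap_mul_add q hr]
  split_ifs <;> omega

/-- As `2 * B` divides `K`, reversal carries aligned blocks to aligned blocks and exchanges their
halves. -/
lemma blockSwap_reverse {B K x : ℕ} (hB : 0 < B) (hK : 2 * B ∣ K) (hx : x < K) :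
    blockSwap B (K - 1 - x) = K - 1 - blockSwap B x := by
  obtain ⟨q, r, hr, rfl⟩ := exists_eq_mul_add hB x
  obtain ⟨m, rfl⟩ := hK
  have h1 : q < m := by
    by_contra h
    have := Nat.mul_le_mul_left (2 * B) (not_lt.1 h)
    omega
  obtain ⟨d, rfl⟩ : ∃ d, m = q + 1 + d := ⟨m - (q + 1), by omega⟩
  rw [blockSwap_mul_add q hr, show 2 * B * (q + 1 + d) - 1 - (2 * B * q + r) =
    2 * B * d + (2 * B - 1 - r) by rw [mul_add, mul_add]; omega, blockSwap_mul_add d (by omega)]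
  rw [mul_add, mul_add]
  split_ifs <;> omega

lemma blockSwap_of_lt {B x : ℕ} (hx : x < B) : blockSwap B x = x + B := by
  have := blockSwap_mul_add (B := B) (r := x) 0 (by omega)
  simpa [hx] using this

lemma blockSwap_one_of_even {x : ℕ} (hx : x % 2 = 0) : blockSwap 1 x = x + 1 := by
  simp [blockSwap, hx]

lemma blockSwap_one_of_odd {x : ℕ} (hx : x % 2 = 1) : blockSwap 1 x = x - 1 := by
  simp [blockSwap, hx]

/-- The permutation of `Fin L` that swaps the two halves of every aligned block of length
`2 * B`. -/
def blockSwapPerm (L B : ℕ) (hB : 0 < B) (hL : 2 * B ∣ L) : Equiv.Perm (Fin L) where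
  toFun x := ⟨blockSwap B x, blockSwap_lt hB hL x.isLt⟩
  invFun x := ⟨blockSwap B x, blockSwap_lt hB hL x.isLt⟩
  left_inv x := by ext; exact blockSwap_blockSwap hB x
  right_inv x := by ext; exact blockSwap_blockSwap hB x

@[simp] lemma blockSwapPerm_val (L B : ℕ) (hB : 0 < B) (hL : 2 * B ∣ L) (x : Fin L) :
    (blockSwapPerm L B hB hL x : ℕ) = blockSwap B x := rfl

/-- The admissible block lengths for the parameter `M`. -/
def IsBlockLength (M B : ℕ) : Prop := ∃ i, B = 2 ^ i ∨ B = 2 ^ i * M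

lemma IsBlockLength.two_mul {M B : ℕ} (h : IsBlockLength M B) : IsBlockLength M (2 * B) := by
  obtain ⟨i, rfl | rfl⟩ := h
  · exact ⟨i + 1, Or.inl (by ring)⟩
  · exact ⟨i + 1, Or.inr (by ring)⟩

/-- The block swaps of `Fin L` with admissible block lengths. -/
def blockSwaps (M L : ℕ) : Set (Equiv.Perm (Fin L)) :=
  {g | ∃ B hB hL, IsBlockLength M B ∧ g = blockSwapPerm L B hB hL}

/-- The group generated by the block swaps with admissible block lengths. -/
def blockSwapGroup (M L : ℕ) : Subgroup (Equiv.Perm (Fin L)) := Subgroup.closure (blockSwaps M L)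

/-- The group generated by the block swaps of a deck of `2 * n` cards and by their conjugates under
the out shuffle. -/
def shuffledSwapGroup (M n : ℕ) : Subgroup (Equiv.Perm (Fin (2 * n))) :=
  blockSwapGroup M (2 * n) ⊔ (blockSwapGroup M (2 * n)).map (MulAut.conj (outHorseshoe n)).toMonoidHom

lemma blockSwapPerm_mem {M L B : ℕ} (hB : 0 < B) (hL : 2 * B ∣ L) (h : IsBlockLength M B) :
    blockSwapPerm L B hB hL ∈ blockSwapGroup M L :=
  Subgroup.subset_closure ⟨B, hB, hL, h, rfl⟩

lemma blockSwapGroup_le (M n : ℕ) : blockSwapGroup M (2 * n) ≤ shuffledSwapGroup M n := le_sup_left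

lemma conj_mem_shuffledSwapGroup {M n : ℕ} {g : Equiv.Perm (Fin (2 * n))}
    (hg : g ∈ blockSwapGroup M (2 * n)) :
    outHorseshoe n * g * (outHorseshoe n)⁻¹ ∈ shuffledSwapGroup M n :=
  (le_sup_right : _ ≤ shuffledSwapGroup M n) (Subgroup.mem_map_of_mem _ hg)

/-! ### The chain of conjugate involutions inside the shuffle group. -/

lemma outHorseshoe_of_lt {n : ℕ} {i : Fin (2 * n)} (h : (i : ℕ) < n) :
    (outHorseshoe n i : ℕ) = 2 * i := if_pos h

lemma outHorseshoe_of_le {n : ℕ} {i : Fin (2 * n)} (h : n ≤ (i : ℕ)) :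
    (outHorseshoe n i : ℕ) = 2 * (2 * n - 1 - i) + 1 := if_neg (not_lt.2 h)

lemma inHorseshoe_of_lt {n : ℕ} {i : Fin (2 * n)} (h : (i : ℕ) < n) :
    (inHorseshoe n i : ℕ) = 2 * i + 1 := if_pos h

lemma inHorseshoe_of_le {n : ℕ} {i : Fin (2 * n)} (h : n ≤ (i : ℕ)) :
    (inHorseshoe n i : ℕ) = 2 * (2 * n - 1 - i) := if_neg (not_lt.2 h)

lemma rev_val (n : ℕ) (i : Fin n) : (Fin.revPerm i : ℕ) = n - 1 - i := by
  simp [Fin.val_rev]; omega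

lemma outHorseshoe_mem (n : ℕ) : outHorseshoe n ∈ Horse n := Subgroup.subset_closure (by simp)

lemma inHorseshoe_mem (n : ℕ) : inHorseshoe n ∈ Horse n := Subgroup.subset_closure (by simp)

lemma outHorseshoe_mul_revPerm (n : ℕ) : outHorseshoe n * Fin.revPerm = inHorseshoe n := by
  ext i
  have := i.isLt
  have h1 := rev_val (2 * n) i
  rw [Equiv.Perm.mul_apply]
  rcases lt_or_ge (i : ℕ) n with h | h
  · rw [inHorseshoe_of_lt h, outHorseshoe_of_le (by omega)]; omega
  · rw [inHorseshoe_of_le h, outHorseshoe_of_lt (by omega)]; omega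

lemma revPerm_mem (n : ℕ) : (Fin.revPerm : Equiv.Perm (Fin (2 * n))) ∈ Horse n := by
  have : (Fin.revPerm : Equiv.Perm (Fin (2 * n))) = (outHorseshoe n)⁻¹ * inHorseshoe n := by
    rw [← outHorseshoe_mul_revPerm]; group
  rw [this]
  exact mul_mem (inv_mem (outHorseshoe_mem n)) (inHorseshoe_mem n)

/-- Conjugation by the out shuffle doubles the block length. -/
lemma outHorseshoe_conj_blockSwapPerm {n B : ℕ} (hB : 0 < B) (hn : 2 * B ∣ n) :
    outHorseshoe n * blockSwapPerm (2 * n) B hB (hn.mul_left 2) * (outHorseshoe n)⁻¹ =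
      blockSwapPerm (2 * n) (2 * B) (by omega) (Nat.mul_dvd_mul_left 2 hn) := by
  rw [mul_inv_eq_iff_eq_mul]
  ext x
  have hx := x.isLt
  have h1 := blockSwap_reverse hB (hn.mul_left 2) hx
  rw [Equiv.Perm.mul_apply, Equiv.Perm.mul_apply, blockSwapPerm_val]
  rcases lt_or_ge (x : ℕ) n with h | h
  · rw [outHorseshoe_of_lt (blockSwap_lt hB hn h), outHorseshoe_of_lt h, blockSwap_two_mul hB,
      blockSwapPerm_val]
  · have h3 := blockSwap_lt hB hn (x := 2 * n - 1 - x) (by omega)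
    have h4 := blockSwap_lt hB (hn.mul_left 2) hx
    rw [outHorseshoe_of_le (by rw [blockSwapPerm_val]; omega), outHorseshoe_of_le h,
      blockSwap_two_mul_add_one hB, h1, blockSwapPerm_val]

/-- For `i < n` the cards `i` and `i + n` go to the mirror images `2 * i` and `2 * n - 1 - 2 * i`.
-/
lemma outHorseshoe_conj_blockSwapPerm_self {n : ℕ} (hn : 0 < n) :
    outHorseshoe n * blockSwapPerm (2 * n) n hn dvd_rfl * (outHorseshoe n)⁻¹ = Fin.revPerm := by
  rw [mul_inv_eq_iff_eq_mul]
  ext x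
  have hx := x.isLt
  have h1 := blockSwapPerm_val (2 * n) n hn dvd_rfl x
  have h2 := rev_val (2 * n) (outHorseshoe n x)
  rw [blockSwap, Nat.mod_eq_of_lt hx] at h1
  rw [Equiv.Perm.mul_apply, Equiv.Perm.mul_apply]
  rcases lt_or_ge (x : ℕ) n with h | h
  · rw [if_pos h] at h1
    rw [outHorseshoe_of_lt h] at h2
    rw [outHorseshoe_of_le (by omega)]
    omega
  · rw [if_neg (not_lt.2 h)] at h1
    rw [outHorseshoe_of_le h] at h2
    rw [outHorseshoe_of_lt (by omega)]
    omega

/-- For `i < n` the mirror images `i` and `2 * n - 1 - i` become the neighbours `2 * i` and `2 * i +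
1`. -/
lemma outHorseshoe_conj_revPerm {n : ℕ} :
    outHorseshoe n * Fin.revPerm * (outHorseshoe n)⁻¹ =
      blockSwapPerm (2 * n) 1 one_pos (by simp) := by
  rw [mul_inv_eq_iff_eq_mul]
  ext x
  have hx := x.isLt
  have h1 := blockSwapPerm_val (2 * n) 1 one_pos (by simp) (outHorseshoe n x)
  have h2 := rev_val (2 * n) x
  rw [Equiv.Perm.mul_apply, Equiv.Perm.mul_apply]
  rcases lt_or_ge (x : ℕ) n with h | h
  · rw [outHorseshoe_of_lt h, blockSwap_one_of_even (by omega)] at h1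
    rw [outHorseshoe_of_le (by omega)]
    omega
  · rw [outHorseshoe_of_le h, blockSwap_one_of_odd (by omega)] at h1
    rw [outHorseshoe_of_lt (by omega)]
    omega

lemma conj_outHorseshoe_mem_iff {n : ℕ} {g : Equiv.Perm (Fin (2 * n))} :
    outHorseshoe n * g * (outHorseshoe n)⁻¹ ∈ Horse n ↔ g ∈ Horse n := by
  rw [Subgroup.mul_mem_cancel_right _ (inv_mem (outHorseshoe_mem n)),
    Subgroup.mul_mem_cancel_left _ (outHorseshoe_mem n)]

lemma two_pow_dvd_of_dvd {M i a : ℕ} (hM : Odd M) (h : 2 ^ i ∣ 2 ^ a * M) : i ≤ a := by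
  have : 2 ^ i ∣ 2 ^ a := Nat.Coprime.dvd_of_dvd_mul_right
    (Nat.Coprime.pow_left _ (Nat.coprime_two_left.2 hM)) h
  exact (Nat.pow_dvd_pow_iff_le_right (by norm_num)).1 this

/-- This follows the chain forwards from the reversal; the next lemma follows it backwards from the
swap of length `n`. -/
lemma blockSwapPerm_two_pow_mem_Horse {n : ℕ} (i : ℕ) (h : 2 * 2 ^ i ∣ 2 * n) :
    blockSwapPerm (2 * n) (2 ^ i) (by positivity) h ∈ Horse n := by
  induction i with
  | zero =>
    have := conj_outHorseshoe_mem_iff.2 (revPerm_mem n)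
    rw [outHorseshoe_conj_revPerm] at this
    exact this
  | succ i ih =>
    have h1 : 2 * 2 ^ i ∣ n := by
      rw [pow_succ'] at h
      exact Nat.dvd_of_mul_dvd_mul_left (by norm_num) h
    have := conj_outHorseshoe_mem_iff.2 (ih (h1.mul_left 2))
    rw [outHorseshoe_conj_blockSwapPerm _ h1] at this
    convert this using 2
    ring

lemma blockSwapPerm_div_two_pow_mem_Horse {n : ℕ} (j B : ℕ) (hB : 0 < B)
    (h : n = 2 ^ j * B) : blockSwapPerm (2 * n) B hB ⟨2 ^ j, by rw [h]; ring⟩ ∈ Horse n := by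
  induction j generalizing B with
  | zero =>
    obtain rfl : n = B := by simpa using h
    rw [← conj_outHorseshoe_mem_iff, outHorseshoe_conj_blockSwapPerm_self]
    exact revPerm_mem n
  | succ j ih =>
    have h1 : 2 * B ∣ n := ⟨2 ^ j, by rw [h]; ring⟩
    rw [← conj_outHorseshoe_mem_iff, outHorseshoe_conj_blockSwapPerm _ h1]
    exact ih (2 * B) (by omega) (by rw [h]; ring)

lemma blockSwapGroup_le_Horse {M n a : ℕ} (hM : Odd M) (h : n = 2 ^ a * M) :
    blockSwapGroup M (2 * n) ≤ Horse n := by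
  refine (Subgroup.closure_le _).2 ?_
  rintro _ ⟨B, hB, hL, ⟨i, rfl | rfl⟩, rfl⟩
  · exact blockSwapPerm_two_pow_mem_Horse i hL
  · have h1 : 2 ^ i ∣ 2 ^ a * M :=
      Nat.dvd_of_mul_dvd_mul_left (by norm_num : 0 < 2)
        (h ▸ (Dvd.intro M (mul_assoc 2 (2 ^ i) M)).trans hL)
    have h2 := two_pow_dvd_of_dvd hM h1
    refine blockSwapPerm_div_two_pow_mem_Horse (a - i) _ hB ?_
    rw [← mul_assoc, ← pow_add, h]
    congr 2
    omega

lemma shuffledSwapGroup_le_Horse {M n a : ℕ} (hM : Odd M) (h : n = 2 ^ a * M) :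
    shuffledSwapGroup M n ≤ Horse n := by
  refine sup_le (blockSwapGroup_le_Horse hM h) ?_
  rintro _ ⟨g, hg, rfl⟩
  exact conj_outHorseshoe_mem_iff.2 (blockSwapGroup_le_Horse hM h hg)

/-! ### Three-cycles, commutators and blocks of permutation groups. -/

lemma perm_inv_apply_self {α : Type*} (g : Equiv.Perm α) (x : α) : g⁻¹ (g x) = x :=
  g.symm_apply_apply x

/-- The permutation `c` is the cycle `p ↦ q ↦ r ↦ p`. -/
def CyclesTriple {α : Type*} (c : Equiv.Perm α) (p q r : α) : Prop :=
  c p = q ∧ c q = r ∧ c r = p ∧ ∀ x, x ≠ p → x ≠ q → x ≠ r → c x = x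

lemma CyclesTriple.isThreeCycle {α : Type*} [Fintype α] [DecidableEq α] {c : Equiv.Perm α}
    {p q r : α} (h : CyclesTriple c p q r) (hpq : p ≠ q) : c.IsThreeCycle := by
  obtain ⟨h1, h2, h3, h4⟩ := h
  have hqr : q ≠ r := fun e => hpq (c.injective (by rw [h1, h2, e]))
  have hrp : r ≠ p := fun e => hqr (c.injective (by rw [h2, h3, e]))
  rw [← card_support_eq_three_iff]
  have : c.support = {p, q, r} := by
    ext x
    simp only [Equiv.Perm.mem_support, Finset.mem_insert, Finset.mem_singleton]
    constructor
    · intro hx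
      by_contra! hc
      exact hx (h4 x hc.1 hc.2.1 hc.2.2)
    · rintro (rfl | rfl | rfl)
      · rw [h1]; exact hpq.symm
      · rw [h2]; exact hqr.symm
      · rw [h3]; exact hrp.symm
  rw [this, Finset.card_eq_three]
  exact ⟨p, q, r, hpq, hrp.symm, hqr, rfl⟩

/-- If the supports of two permutations meet in exactly one point, their commutator is a
three-cycle. -/
lemma cyclesTriple_commutator {α : Type*} {a b : Equiv.Perm α} {p : α} (ha : a p ≠ p)
    (hb : b p ≠ p) (h : ∀ x, a x ≠ x → b x ≠ x → x = p) :
    CyclesTriple (a * b * a⁻¹ * b⁻¹) p (a p) (b p) := by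
  have fa : ∀ x, x ≠ p → b x ≠ x → a x = x := fun x hx hbx => by
    by_contra hc; exact hx (h x hc hbx)
  have fb : ∀ x, x ≠ p → a x ≠ x → b x = x := fun x hx hbx => by
    by_contra hc; exact hx (h x hbx hc)
  have ia : ∀ {x y}, a x = y → a⁻¹ y = x := fun e => by rw [← e]; simp
  have ib : ∀ {x y}, b x = y → b⁻¹ y = x := fun e => by rw [← e]; simp
  have hab : a p ≠ b p := by
    intro e
    apply ha
    apply h
    · exact fun e' => ha (a.injective e')
    · rw [e]; exact fun e' => hb (b.injective e')
  -- `a p` is moved by `a` and differs from `p`, the only common point of the supports, so `b` fixes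
  -- it.
  have b_ap : b (a p) = a p := fb _ ha (fun e => ha (a.injective e))
  have a_bp : a (b p) = b p := fa _ hb (fun e => hb (b.injective e))
  have key : ∀ x, (a * b * a⁻¹ * b⁻¹) x = a (b (a⁻¹ (b⁻¹ x))) := fun x => rfl
  refine ⟨?_, ?_, ?_, fun x h1 h2 h3 => ?_⟩
  · obtain ⟨s, hs⟩ := b.surjective p
    have hsp : s ≠ p := by rintro rfl; exact hb hs
    have has : a s = s := fa s hsp (by rw [hs]; exact hsp.symm)
    rw [key, ib hs, ia has, hs]
  · rw [key, ib b_ap, ia rfl, a_bp]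
  · obtain ⟨s, hs⟩ := a.surjective p
    have hsp : s ≠ p := by rintro rfl; exact ha hs
    have hbs : b s = s := fb s hsp (by rw [hs]; exact hsp.symm)
    rw [key, ib rfl, ia hs, hbs, hs]
  · rw [key]
    by_cases hbx : b x = x
    · rw [ib hbx]
      obtain ⟨s, hs⟩ := a.surjective x
      have hsp : s ≠ p := by rintro rfl; exact h2 hs.symm
      by_cases has : a s = s
      · obtain rfl : s = x := has.symm.trans hs
        rw [ia has, hbx, has]
      · rw [ia hs, fb s hsp has, hs]
    · obtain ⟨s, hs⟩ := b.surjective x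
      have hsp : s ≠ p := by rintro rfl; exact h3 hs.symm
      have hax : a x = x := fa x h1 hbx
      have hbs : b s ≠ s := by
        intro e
        obtain rfl : s = x := e.symm.trans hs
        exact hbx e
      rw [ib hs, ia (fa s hsp hbs), hs, hax]

lemma apply_mem_of_isBlock {α : Type*} {G : Subgroup (Equiv.Perm α)} {B : Set α}
    (hB : MulAction.IsBlock G B) {g : Equiv.Perm α} (hg : g ∈ G) {x y : α} (hx : x ∈ B)
    (hgx : g x ∈ B) (hy : y ∈ B) : g y ∈ B := by
  have h := MulAction.isBlock_iff_smul_eq_of_mem.1 hB (g := ⟨g, hg⟩) hx hgx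
  rw [← h]
  exact Set.smul_mem_smul_set hy

/-- A second point of the block lies on the cycle or is fixed by `c`; either way some point of the
block stays in it under `c`, so `c` preserves the block. -/
lemma CyclesTriple.mem_of_isBlock {α : Type*} {G : Subgroup (Equiv.Perm α)} {B : Set α}
    (hB : MulAction.IsBlock G B) {c : Equiv.Perm α} (hc : c ∈ G) {p q r : α}
    (h : CyclesTriple c p q r) (hp : p ∈ B) (hnt : ∃ y ∈ B, y ≠ p) : q ∈ B ∧ r ∈ B := by
  obtain ⟨h1, h2, h3, h4⟩ := h
  have hq : q ∈ B → q ∈ B ∧ r ∈ B := fun hq =>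
    ⟨hq, h2 ▸ apply_mem_of_isBlock hB hc hp (h1.symm ▸ hq) hq⟩
  have hr : r ∈ B → q ∈ B ∧ r ∈ B := fun hr =>
    ⟨h1 ▸ apply_mem_of_isBlock hB hc hr (h3.symm ▸ hp) hp, hr⟩
  obtain ⟨y, hy, hyp⟩ := hnt
  by_cases hyq : y = q
  · exact hq (hyq ▸ hy)
  by_cases hyr : y = r
  · exact hr (hyr ▸ hy)
  · exact hq (h1 ▸ apply_mem_of_isBlock hB hc hy ((h4 y hyp hyq hyr).symm ▸ hy) hp)

/-- Jordan's theorem on primitive groups with a three-cycle, with primitivity spelled out. -/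
lemma alternatingGroup_le_of_blocks {α : Type*} [Fintype α] [DecidableEq α]
    {G : Subgroup (Equiv.Perm α)} (htrans : ∀ x y, ∃ g ∈ G, g x = y)
    (hblock : ∀ B : Set α, MulAction.IsBlock G B → ∀ x ∈ B, ∀ y ∈ B, x ≠ y → B = Set.univ)
    {c : Equiv.Perm α} (hc : c ∈ G) (h3 : c.IsThreeCycle) : alternatingGroup α ≤ G := by
  have h1 : MulAction.IsPretransitive G α := ⟨fun x y => by
    obtain ⟨g, hg, h⟩ := htrans x y
    exact ⟨⟨g, hg⟩, h⟩⟩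
  have h2 : MulAction.IsPreprimitive G α := ⟨fun {B} hB => by
    by_cases hs : B.Subsingleton
    · exact Or.inl hs
    · rw [Set.not_subsingleton_iff] at hs
      obtain ⟨x, hx, y, hy, hxy⟩ := hs
      exact Or.inr (hblock B hB x hx y hy hxy)⟩
  exact Equiv.Perm.alternatingGroup_le_of_isPreprimitive_of_isThreeCycle_mem h2 h3 hc

/-! ### The double cover by reversal and lifts of three-cycles. -/

/-- The class of a card under the reversal of the deck. -/
def foldFin {N : ℕ} (x : Fin (2 * N)) : Fin N := ⟨min x (2 * N - 1 - x), by omega⟩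

/-- The class of a card under the swaps of adjacent cards. -/
def halfFin {N : ℕ} (x : Fin (2 * N)) : Fin N := ⟨x / 2, by omega⟩

lemma foldFin_val {N : ℕ} (x : Fin (2 * N)) : (foldFin x : ℕ) = min (x : ℕ) (2 * N - 1 - x) := rfl

lemma halfFin_val {N : ℕ} (x : Fin (2 * N)) : (halfFin x : ℕ) = x / 2 := rfl

lemma foldFin_eq_iff {N : ℕ} {x y : Fin (2 * N)} :
    foldFin x = foldFin y ↔ x = y ∨ x = Fin.revPerm y := by
  rw [Fin.ext_iff, Fin.ext_iff, Fin.ext_iff, foldFin_val, foldFin_val, rev_val]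
  omega

lemma foldFin_rev {N : ℕ} (x : Fin (2 * N)) : foldFin (Fin.revPerm x) = foldFin x := by
  rw [foldFin_eq_iff]; exact Or.inr rfl

lemma halfFin_outHorseshoe {N : ℕ} (x : Fin (2 * N)) : halfFin (outHorseshoe N x) = foldFin x := by
  rw [Fin.ext_iff, foldFin_val, halfFin_val]
  rcases lt_or_ge (x : ℕ) N with h | h
  · rw [outHorseshoe_of_lt h]; omega
  · rw [outHorseshoe_of_le h]; omega

/-- The permutations `g` of `Fin N` that have a lift `h` in `G` to the double cover
`foldFin : Fin (2 * N) → Fin N`. -/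
def foldSubgroup {N : ℕ} (G : Subgroup (Equiv.Perm (Fin (2 * N)))) :
    Subgroup (Equiv.Perm (Fin N)) where
  carrier := {g | ∃ h ∈ G, ∀ x, foldFin (h x) = g (foldFin x)}
  one_mem' := ⟨1, one_mem _, fun _ => rfl⟩
  mul_mem' := by
    rintro a b ⟨h, hh, ha⟩ ⟨k, hk, hb⟩
    exact ⟨h * k, mul_mem hh hk, fun x => by simp [ha, hb]⟩
  inv_mem' := by
    rintro a ⟨h, hh, ha⟩
    refine ⟨h⁻¹, inv_mem hh, fun x => ?_⟩
    rw [Equiv.Perm.eq_inv_iff_eq, ← ha]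
    simp

lemma foldFin_blockSwapPerm {N B : ℕ} (hB : 0 < B) (h : 2 * B ∣ N) (x : Fin (2 * N)) :
    foldFin (blockSwapPerm (2 * N) B hB (h.mul_left 2) x) = blockSwapPerm N B hB h (foldFin x) := by
  have hx := x.isLt
  have h1 := blockSwap_reverse hB (h.mul_left 2) hx
  have h2 := blockSwap_lt hB (h.mul_left 2) hx
  rw [Fin.ext_iff, foldFin_val, blockSwapPerm_val, blockSwapPerm_val, foldFin_val]
  rcases lt_or_ge (x : ℕ) N with hl | hl
  · have h3 := blockSwap_lt hB h hl
    rw [min_eq_left (b := 2 * N - 1 - (x : ℕ)) (by omega)]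
    omega
  · have h3 := blockSwap_lt hB h (x := 2 * N - 1 - x) (by omega)
    rw [min_eq_right (b := 2 * N - 1 - (x : ℕ)) (by omega)]
    omega

/-- Doubling a position of the small deck and then folding is the out shuffle of the small deck, and
doubling turns the swap of length `B` into that of length `2 * B`. This is how the conjugated swaps
arise in the quotient. -/
lemma foldFin_blockSwapPerm_two_mul {n B : ℕ} (hB : 0 < B) (h : 2 * B ∣ 2 * n)
    (x : Fin (2 * (2 * n))) :
    foldFin (blockSwapPerm (2 * (2 * n)) (2 * B) (by omega) (Nat.mul_dvd_mul_left 2 h) x) =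
      (outHorseshoe n * blockSwapPerm (2 * n) B hB h * (outHorseshoe n)⁻¹) (foldFin x) := by
  have hx := x.isLt
  obtain ⟨z, hz⟩ := (outHorseshoe n).surjective (foldFin x)
  have hz' := hz
  have hzn := z.isLt
  have hw := blockSwap_lt hB h hzn
  have h0 : ∀ w : Fin (2 * n), (outHorseshoe n w : ℕ) = min (2 * (w : ℕ)) (2 * (2 * n) - 1 - 2 * w) := by
    intro w
    rcases lt_or_ge (w : ℕ) n with h | h
    · rw [outHorseshoe_of_lt h]; omega
    · rw [outHorseshoe_of_le h]; omega
  rw [← hz, Equiv.Perm.mul_apply, Equiv.Perm.mul_apply, perm_inv_apply_self, Fin.ext_iff, h0,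
    foldFin_val, blockSwapPerm_val, blockSwapPerm_val]
  rw [Fin.ext_iff, h0, foldFin_val] at hz'
  have hx2 : (x : ℕ) = 2 * z ∨ (x : ℕ) = 2 * (2 * n) - 1 - 2 * z := by omega
  have h1 := blockSwap_two_mul hB (z : ℕ)
  have h2 := blockSwap_reverse (B := 2 * B) (K := 2 * (2 * n)) (x := 2 * z) (by omega)
    (Nat.mul_dvd_mul_left 2 h) (by omega)
  rcases hx2 with e | e
  · rw [e, h1]
  · rw [e, h2, h1]
    omega

lemma shuffledSwapGroup_le_foldSubgroup (M n : ℕ) :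
    shuffledSwapGroup M n ≤ foldSubgroup (blockSwapGroup M (2 * (2 * n))) := by
  refine sup_le ((Subgroup.closure_le _).2 ?_) ?_
  · rintro _ ⟨B, hB, hL, hM, rfl⟩
    exact ⟨_, blockSwapPerm_mem hB (hL.mul_left 2) hM, foldFin_blockSwapPerm hB hL⟩
  · rw [Subgroup.map_le_iff_le_comap]
    refine (Subgroup.closure_le _).2 ?_
    rintro _ ⟨B, hB, hL, hM, rfl⟩
    exact ⟨_, blockSwapPerm_mem (by omega) (Nat.mul_dvd_mul_left 2 hL) hM.two_mul,
      foldFin_blockSwapPerm_two_mul hB hL⟩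

/-- Lifts of three-cycles to the double cover, squared so as to fix all other cards. -/
lemma exists_double_cycle {M n : ℕ} (hA : alternatingGroup (Fin (2 * n)) ≤ shuffledSwapGroup M n)
    {x y z : Fin (2 * n)} (hxy : x ≠ y) (hyz : y ≠ z) (hxz : x ≠ z) :
    ∃ a ∈ blockSwapGroup M (2 * (2 * n)), (∀ p, foldFin p = x → foldFin (a p) = y) ∧
      ∀ p, foldFin p ≠ x → foldFin p ≠ y → foldFin p ≠ z → a p = p := by
  -- This is the cycle `x ↦ z ↦ y ↦ x`, so that its square sends `x` to `y`.
  have hc : Equiv.swap x y * Equiv.swap x z ∈ alternatingGroup (Fin (2 * n)) := by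
    simp [Equiv.Perm.mem_alternatingGroup, Equiv.Perm.sign_swap hxy, Equiv.Perm.sign_swap hxz]
  obtain ⟨h, hh, hf⟩ := shuffledSwapGroup_le_foldSubgroup M n (hA hc)
  refine ⟨h * h, mul_mem hh hh, fun p hp => ?_, fun p h1 h2 h3 => ?_⟩
  · rw [Equiv.Perm.mul_apply, hf, hf, hp]
    simp [Equiv.swap_apply_of_ne_of_ne hxz.symm hyz.symm]
  -- The lift permutes the two cards of this fibre, so its square fixes both.
  · have h4 : ∀ q, foldFin q = foldFin p → foldFin (h q) = foldFin p := fun q hq => by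
      rw [hf, hq, Equiv.Perm.mul_apply, Equiv.swap_apply_of_ne_of_ne h1 h3,
        Equiv.swap_apply_of_ne_of_ne h1 h2]
    rw [Equiv.Perm.mul_apply]
    rcases foldFin_eq_iff.1 (h4 p rfl) with e | e
    · rw [e, e]
    · rcases foldFin_eq_iff.1 (h4 (h p) (h4 p rfl)) with e' | e'
      · rw [e']
      · rw [h.injective (e'.trans e.symm), h.injective (e'.trans e.symm)]

/-- Conjugation by the out shuffle turns pairs of mirror images into pairs of adjacent cards. -/
lemma exists_double_cycle' {M n : ℕ} (hA : alternatingGroup (Fin (2 * n)) ≤ shuffledSwapGroup M n)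
    {x y z : Fin (2 * n)} (hxy : x ≠ y) (hyz : y ≠ z) (hxz : x ≠ z) :
    ∃ b ∈ shuffledSwapGroup M (2 * n), (∀ p, halfFin p = x → halfFin (b p) = y) ∧
      ∀ p, halfFin p ≠ x → halfFin p ≠ y → halfFin p ≠ z → b p = p := by
  obtain ⟨a, ha, h1, h2⟩ := exists_double_cycle hA hxy hyz hxz
  refine ⟨_, conj_mem_shuffledSwapGroup ha, fun p hp => ?_, fun p => ?_⟩
  · obtain ⟨q, rfl⟩ := (outHorseshoe (2 * n)).surjective p
    rw [halfFin_outHorseshoe] at hp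
    simp only [Equiv.Perm.mul_apply, perm_inv_apply_self, halfFin_outHorseshoe]
    exact h1 q hp
  · obtain ⟨q, rfl⟩ := (outHorseshoe (2 * n)).surjective p
    simp only [Equiv.Perm.mul_apply, perm_inv_apply_self, halfFin_outHorseshoe]
    intro k1 k2 k3
    rw [h2 q k1 k2 k3]

/-! ### Two-colourings compatible with the block swaps. -/

lemma blockSwap_eq_or (B x : ℕ) : blockSwap B x = x + B ∨ B ≤ x ∧ blockSwap B x = x - B := by
  unfold blockSwap
  split_ifs with h
  · exact Or.inl rfl
  · exact Or.inr ⟨(not_lt.1 h).trans (Nat.mod_le _ _), rfl⟩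

/-- A two-colouring of the deck that every block swap preserves or reverses, and that swapping
adjacent cards reverses, is the colouring by parity. -/
lemma parity_of_blockSwap {P : ℕ → Prop} {a M : ℕ} (ha : 0 < a) (hM : Odd M) (hM3 : 3 ≤ M)
    (hP : ∀ b, 0 < b → IsBlockLength M b → 2 * b ∣ 2 ^ a * M →
      (∀ x < 2 ^ a * M, P (blockSwap b x) ↔ P x) ∨ ∀ x < 2 ^ a * M, P (blockSwap b x) ↔ ¬ P x)
    (h1 : ∀ x < 2 ^ a * M, P (blockSwap 1 x) ↔ ¬ P x) :
    ∀ x < 2 ^ a * M, (P x ↔ x % 2 = 0) ↔ (P 0 ↔ True) := by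
  -- `H` compares the colouring with parity; every block swap preserves or reverses `H` too, and the
  -- goal is that `H` is constant.
  obtain ⟨H, hH⟩ : ∃ H : ℕ → Prop, ∀ x, H x ↔ (P x ↔ x % 2 = 0) := ⟨_, fun _ => Iff.rfl⟩
  have hH1 : ∀ x < 2 ^ a * M, H (blockSwap 1 x) ↔ H x := by
    intro x hx
    rw [hH, hH, h1 x hx]
    rcases Nat.mod_two_eq_zero_or_one x with h | h
    · rw [blockSwap_one_of_even h, h, show (x + 1) % 2 = 1 by omega]; simp
    · rw [blockSwap_one_of_odd h, h, show (x - 1) % 2 = 0 by omega]; simp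
  have hHb : ∀ b, 0 < b → IsBlockLength M b → 2 * b ∣ 2 ^ a * M →
      (∀ x < 2 ^ a * M, H (blockSwap b x) ↔ H x) ∨
        ∀ x < 2 ^ a * M, H (blockSwap b x) ↔ ¬ H x := by
    intro b hb0 hb hd
    rcases Nat.mod_two_eq_zero_or_one b with hb2 | hb2
    · have hpar : ∀ x, blockSwap b x % 2 = x % 2 := fun x => by
        rcases blockSwap_eq_or b x with h | ⟨h', h⟩ <;> omega
      rcases hP b hb0 hb hd with h | h
      · exact Or.inl fun x hx => by rw [hH, hH, h x hx, hpar]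
      · exact Or.inr fun x hx => by rw [hH, hH, h x hx, hpar]; tauto
    · have hpar : ∀ x, blockSwap b x % 2 = 0 ↔ ¬ x % 2 = 0 := fun x => by
        rcases blockSwap_eq_or b x with h | ⟨h', h⟩ <;> omega
      rcases hP b hb0 hb hd with h | h
      · exact Or.inr fun x hx => by rw [hH, hH, h x hx, hpar]; tauto
      · exact Or.inl fun x hx => by rw [hH, hH, h x hx, hpar]; tauto
  have hdvd : ∀ i < a, 2 * (2 ^ i * M) ∣ 2 ^ a * M := fun i hi => by
    rw [← mul_assoc, ← pow_succ']
    exact Nat.mul_dvd_mul_right (pow_dvd_pow 2 hi) M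
  have hdvd2 : ∀ i < a, 2 * 2 ^ i ∣ 2 ^ a * M := fun i hi => by
    rw [← pow_succ']
    exact (pow_dvd_pow 2 hi).mul_right M
  have hshift : ∀ i < a, (∀ x < 2 ^ i * M, H (x + 2 ^ i * M) ↔ H x) ∨
      ∀ x < 2 ^ i * M, H (x + 2 ^ i * M) ↔ ¬ H x := by
    intro i hi
    have hle := Nat.le_of_dvd (by positivity) (hdvd i hi)
    rcases hHb (2 ^ i * M) (by positivity) ⟨i, Or.inr rfl⟩ (hdvd i hi) with h | h
    · exact Or.inl fun x hx => by rw [← h x (by omega), blockSwap_of_lt hx]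
    · exact Or.inr fun x hx => by rw [← h x (by omega), blockSwap_of_lt hx]
  have hMo := Nat.odd_iff.1 hM
  -- Constancy spreads from the first `M` cards by doubling the length of the initial segment.
  have main : ∀ i ≤ a, ∀ x < 2 ^ i * M, H x ↔ H 0 := by
    intro i
    induction i with
    | zero =>
      intro _ x hx
      have h2M := Nat.le_of_dvd (by positivity) (hdvd 0 ha)
      have hs := hshift 0 ha
      rw [pow_zero, one_mul] at hx h2M hs
      induction x with
      | zero => rfl
      | succ x ih =>
        have ih' : H x ↔ H 0 := ih (by omega)
        rw [← ih']
        rcases Nat.mod_two_eq_zero_or_one x with h | h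
        · rw [← hH1 x (by omega), blockSwap_one_of_even h]
        -- For odd `x` the number `x + M` is even, so the link between `x` and `x + 1` is found one
        -- block of length `M` further on.
        · have e := hH1 (x + M) (by omega)
          rw [blockSwap_one_of_even (by omega), show x + M + 1 = x + 1 + M by omega] at e
          rcases hs with hs | hs
          · rwa [hs x (by omega), hs (x + 1) hx] at e
          · rw [hs x (by omega), hs (x + 1) hx] at e
            tauto
    | succ i ih =>
      intro hi x hx
      replace ih := ih (by omega)
      have hle := Nat.le_of_dvd (by positivity) (hdvd i (by omega))
      have hpos : 0 < 2 ^ i * M := by positivity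
      have hpow : 0 < 2 ^ i := by positivity
      have h3 : 2 ^ i * 3 ≤ 2 ^ i * M := Nat.mul_le_mul_left _ hM3
      rw [pow_succ', mul_assoc] at hx
      -- The swap of length `2 ^ i` preserves `H`, since 0 and `2 ^ i` agree; as `M` is odd, it
      -- moves `2 ^ i * M` back into the initial segment.
      have hlink : H (2 ^ i * M) ↔ H 0 := by
        obtain ⟨k, hk⟩ := hM
        have e1 : blockSwap (2 ^ i) (2 ^ i * M) = 2 ^ i * M - 2 ^ i := by
          have := blockSwap_mul_add (B := 2 ^ i) (r := 2 ^ i) k (by omega)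
          rw [if_neg (lt_irrefl _), show 2 * 2 ^ i * k + 2 ^ i = 2 ^ i * M by rw [hk]; ring] at this
          rw [this, hk]
          have : 2 ^ i * (2 * k + 1) = 2 * 2 ^ i * k + 2 ^ i := by ring
          omega
        have e2 : blockSwap (2 ^ i) 0 = 2 ^ i := by rw [blockSwap_of_lt hpow, zero_add]
        have e3 : ∀ y < 2 ^ a * M, H (blockSwap (2 ^ i) y) ↔ H y := by
          rcases hHb (2 ^ i) hpow ⟨i, Or.inl rfl⟩ (hdvd2 i (by omega)) with h | h
          · exact h
          · have := h 0 (by omega)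
            rw [e2, ih (2 ^ i) (by omega)] at this
            tauto
        rw [← e3 _ (by omega), e1]
        exact ih _ (by omega)
      rcases lt_or_ge x (2 ^ i * M) with hlt | hge
      · exact ih x hlt
      · obtain ⟨y, rfl⟩ := Nat.exists_eq_add_of_le' hge
        have hs0 : ∀ x < 2 ^ i * M, H (x + 2 ^ i * M) ↔ H x := by
          rcases hshift i (by omega) with h | h
          · exact h
          · have := h 0 hpos
            rw [zero_add, hlink] at this
            tauto
        rw [hs0 y (by omega)]
        exact ih y (by omega)
  intro x hx
  have := main a le_rfl x hx
  rw [hH, hH] at this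
  simpa using this

/-- No two-colouring of the deck is preserved or reversed by every shuffled block swap, if
swapping adjacent cards reverses it. -/
lemma not_twoColouring {a M n : ℕ} (hM : Odd M) (hM3 : 3 ≤ M) (hn : n = 2 ^ a * M)
    {B : Set (Fin (2 * n))}
    (hB : ∀ g ∈ shuffledSwapGroup M n, (∀ x, g x ∈ B ↔ x ∈ B) ∨ ∀ x, g x ∈ B ↔ x ∉ B)
    (h1 : ∀ x, blockSwapPerm (2 * n) 1 one_pos (by simp) x ∈ B ↔ x ∉ B) : False := by
  have hL : 2 ^ (a + 1) * M = 2 * n := by rw [hn]; ring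
  have hP := parity_of_blockSwap (P := fun x => ∃ h : x < 2 * n, (⟨x, h⟩ : Fin (2 * n)) ∈ B)
    (a := a + 1) (by omega) hM hM3 (by
      rw [hL]
      intro b hb0 hb hd
      have hg := blockSwapGroup_le M n (blockSwapPerm_mem hb0 hd hb)
      rcases hB _ hg with h | h
      · left
        intro x hx
        simpa [hx, blockSwap_lt hb0 hd hx, blockSwapPerm] using h ⟨x, hx⟩
      · right
        intro x hx
        simpa [hx, blockSwap_lt hb0 hd hx, blockSwapPerm] using h ⟨x, hx⟩) (by
      rw [hL]
      intro x hx
      simpa [hx, blockSwap_lt one_pos (show 2 * 1 ∣ 2 * n by simp) hx, blockSwapPerm]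
        using h1 ⟨x, hx⟩)
  rw [hL] at hP
  have hpar : ∀ x y : Fin (2 * n), (x ∈ B ↔ y ∈ B) ↔ (x : ℕ) % 2 = (y : ℕ) % 2 := by
    intro x y
    have hx := hP x x.isLt
    have hy := hP y y.isLt
    simp only [Fin.is_lt, exists_true_left, Fin.eta] at hx hy
    rcases Nat.mod_two_eq_zero_or_one x with e | e <;>
    rcases Nat.mod_two_eq_zero_or_one y with e' | e' <;>
    · rw [e] at hx ⊢
      rw [e'] at hy ⊢
      simp only [one_ne_zero, zero_ne_one, iff_true, iff_false] at hx hy ⊢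
      tauto
  have hpow : 0 < 2 ^ a := by positivity
  have h3 : 2 ^ a * 3 ≤ n := by rw [hn]; exact Nat.mul_le_mul_left _ hM3
  have hd : 2 * 2 ^ a ∣ 2 * n := by rw [hn, ← mul_assoc]; exact Dvd.intro _ rfl
  have hg := conj_mem_shuffledSwapGroup (M := M) (blockSwapPerm_mem hpow hd ⟨a, Or.inl rfl⟩)
  set g := outHorseshoe n * blockSwapPerm (2 * n) (2 ^ a) hpow hd * (outHorseshoe n)⁻¹ with hgd
  have hgO : ∀ x, g (outHorseshoe n x) = outHorseshoe n (blockSwapPerm (2 * n) (2 ^ a) hpow hd x) := by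
    intro x
    rw [hgd, Equiv.Perm.mul_apply, Equiv.Perm.mul_apply, perm_inv_apply_self]
  -- The colouring is by parity. At the image of 0, `g` preserves parity; at the image of `n` it
  -- reverses it, because the swap takes `n` into the top half.
  have key : (g (outHorseshoe n ⟨0, by omega⟩) ∈ B ↔ outHorseshoe n ⟨0, by omega⟩ ∈ B) ↔
      (g (outHorseshoe n ⟨n, by omega⟩) ∈ B ↔ outHorseshoe n ⟨n, by omega⟩ ∈ B) := by
    rcases hB g hg with h | h <;> rw [h, h] <;> tauto
  rw [hpar, hpar, hgO, hgO] at key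
  have e1 : (blockSwapPerm (2 * n) (2 ^ a) hpow hd ⟨0, by omega⟩ : ℕ) = 2 ^ a := by
    rw [blockSwapPerm_val, blockSwap_of_lt hpow, zero_add]
  have e2 : (blockSwapPerm (2 * n) (2 ^ a) hpow hd ⟨n, by omega⟩ : ℕ) = n - 2 ^ a := by
    obtain ⟨k, hk⟩ := hM
    have := blockSwap_mul_add (B := 2 ^ a) (r := 2 ^ a) k (by omega)
    rw [if_neg (lt_irrefl _), show 2 * 2 ^ a * k + 2 ^ a = n by rw [hn, hk]; ring] at this
    rw [blockSwapPerm_val, this]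
    have : n = 2 * 2 ^ a * k + 2 ^ a := by rw [hn, hk]; ring
    omega
  rw [outHorseshoe_of_lt (i := ⟨0, _⟩) (by dsimp only; omega),
    outHorseshoe_of_le (i := ⟨n, _⟩) (by dsimp only; omega),
    outHorseshoe_of_lt (by omega), outHorseshoe_of_lt (by omega), e1, e2] at key
  dsimp only at key
  omega

/-! ### Orbits under reversal and adjacent swaps. -/

/-- The index of the orbit of a card under reversing the deck and swapping adjacent cards. -/
def orbitIndex {N : ℕ} (x : Fin (2 * N)) : ℕ := min (x : ℕ) (2 * N - 1 - x) / 2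

/-- Swapping adjacent cards. -/
def adjacentSwap (N : ℕ) : Equiv.Perm (Fin (2 * N)) := blockSwapPerm (2 * N) 1 one_pos (by simp)

lemma adjacentSwap_val {N : ℕ} (x : Fin (2 * N)) :
    (adjacentSwap N x : ℕ) = x / 2 * 2 + (1 - x % 2) := by
  rw [adjacentSwap, blockSwapPerm_val]
  rcases Nat.mod_two_eq_zero_or_one x with h | h
  · rw [blockSwap_one_of_even h]; omega
  · rw [blockSwap_one_of_odd h]; omega

lemma halfFin_eq_iff {N : ℕ} {x y : Fin (2 * N)} :
    halfFin x = halfFin y ↔ x = y ∨ x = adjacentSwap N y := by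
  rw [Fin.ext_iff, Fin.ext_iff, Fin.ext_iff, halfFin_val, halfFin_val, adjacentSwap_val]
  omega

lemma orbitIndex_rev {N : ℕ} (x : Fin (2 * N)) : orbitIndex (Fin.revPerm x) = orbitIndex x := by
  have := x.isLt
  rw [orbitIndex, orbitIndex, rev_val]
  omega

lemma orbitIndex_adjacentSwap {n : ℕ} (x : Fin (2 * (2 * n))) :
    orbitIndex (adjacentSwap (2 * n) x) = orbitIndex x := by
  have := x.isLt
  rw [orbitIndex, orbitIndex, adjacentSwap_val]
  omega

lemma orbitIndex_eq_of_halfFin_eq {n : ℕ} {x y : Fin (2 * (2 * n))} (h : halfFin x = halfFin y) :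
    orbitIndex x = orbitIndex y := by
  rw [Fin.ext_iff, halfFin_val, halfFin_val] at h
  rw [orbitIndex, orbitIndex]
  omega

lemma foldFin_ne_foldFin_adjacentSwap {n : ℕ} (x : Fin (2 * (2 * n))) :
    foldFin x ≠ foldFin (adjacentSwap (2 * n) x) := by
  have := x.isLt
  rw [Ne, Fin.ext_iff, foldFin_val, foldFin_val, adjacentSwap_val]
  omega

lemma halfFin_ne_halfFin_rev {n : ℕ} (x : Fin (2 * (2 * n))) :
    halfFin x ≠ halfFin (Fin.revPerm x) := by
  have := x.isLt
  rw [Ne, Fin.ext_iff, halfFin_val, halfFin_val, rev_val]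
  omega

lemma eq_of_orbitIndex_eq {n : ℕ} {x y : Fin (2 * (2 * n))} (h : orbitIndex x = orbitIndex y) :
    x = y ∨ x = Fin.revPerm y ∨ x = adjacentSwap (2 * n) y ∨
      x = Fin.revPerm (adjacentSwap (2 * n) y) := by
  have := x.isLt
  have := y.isLt
  rw [Fin.ext_iff, Fin.ext_iff, Fin.ext_iff, Fin.ext_iff, rev_val, rev_val, adjacentSwap_val]
  rw [orbitIndex, orbitIndex] at h
  omega

lemma exists_orbitIndex {n : ℕ} (hn : 3 ≤ n) (i j : ℕ) :
    ∃ s : Fin (2 * (2 * n)), orbitIndex s ≠ i ∧ orbitIndex s ≠ j := by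
  by_cases h0 : 0 ≠ i ∧ 0 ≠ j
  · exact ⟨⟨0, by omega⟩, by simpa [orbitIndex] using h0⟩
  by_cases h1 : 1 ≠ i ∧ 1 ≠ j
  · refine ⟨⟨2, by omega⟩, ?_⟩
    have : orbitIndex (⟨2, by omega⟩ : Fin (2 * (2 * n))) = 1 := by
      rw [orbitIndex]; dsimp only; omega
    rwa [this]
  · refine ⟨⟨4, by omega⟩, ?_⟩
    have : orbitIndex (⟨4, by omega⟩ : Fin (2 * (2 * n))) = 2 := by
      rw [orbitIndex]; dsimp only; omega
    rw [this]
    omega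

/-! ### The doubling step. -/

section step

variable {M n : ℕ}

/-- Take `a` supported on the mirror pairs of `p`, `q` and the neighbour of `q`, and `b` on the
adjacent pairs of `p`, `s` and the mirror image of `s`. The orbits of `p`, `q`, `s` being distinct,
the supports can only meet where the mirror pair and the adjacent pair of `p` do, which is in `p`
alone. -/
lemma exists_cyclesTriple (hA : alternatingGroup (Fin (2 * n)) ≤ shuffledSwapGroup M n)
    {p q s : Fin (2 * (2 * n))} (h1 : orbitIndex p ≠ orbitIndex q)
    (h2 : orbitIndex q ≠ orbitIndex s) (h3 : orbitIndex p ≠ orbitIndex s) :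
    ∃ c ∈ shuffledSwapGroup M (2 * n), ∃ u v, CyclesTriple c p u v ∧ p ≠ u ∧
      foldFin u = foldFin q ∧ halfFin v = halfFin s := by
  have hfold : ∀ {s t : Fin (2 * (2 * n))}, foldFin s = foldFin t → orbitIndex s = orbitIndex t :=
    fun e => congrArg (fun t : Fin (2 * n) => (t : ℕ) / 2) e
  obtain ⟨a, ha, a1, a2⟩ := exists_double_cycle hA (x := foldFin p) (y := foldFin q)
    (z := foldFin (adjacentSwap _ q)) (fun e => h1 (hfold e)) (foldFin_ne_foldFin_adjacentSwap q)
    (fun e => h1 ((hfold e).trans (orbitIndex_adjacentSwap q)))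
  obtain ⟨b, hb, b1, b2⟩ := exists_double_cycle' hA (x := halfFin p) (y := halfFin s)
    (z := halfFin (Fin.revPerm s)) (fun e => h3 (orbitIndex_eq_of_halfFin_eq e))
    (halfFin_ne_halfFin_rev s)
    (fun e => h3 ((orbitIndex_eq_of_halfFin_eq e).trans (orbitIndex_rev s)))
  have ha' := blockSwapGroup_le M (2 * n) ha
  have hap : p ≠ a p := fun e => h1 (hfold (e ▸ a1 p rfl))
  have hbp : b p ≠ p := fun e => h3 (orbitIndex_eq_of_halfFin_eq (e ▸ b1 p rfl))
  refine ⟨a * b * a⁻¹ * b⁻¹, mul_mem (mul_mem (mul_mem ha' hb) (inv_mem ha')) (inv_mem hb), a p, b p,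
    cyclesTriple_commutator hap.symm hbp ?_, hap, a1 p rfl, b1 p rfl⟩
  intro x hax hbx
  have := x.isLt
  have ka : foldFin x = foldFin p ∨ foldFin x = foldFin q ∨ foldFin x = foldFin (adjacentSwap _ q) := by
    by_contra! hc
    exact hax (a2 x hc.1 hc.2.1 hc.2.2)
  have kb : halfFin x = halfFin p ∨ halfFin x = halfFin s ∨ halfFin x = halfFin (Fin.revPerm s) := by
    by_contra! hc
    exact hbx (b2 x hc.1 hc.2.1 hc.2.2)
  have ka' : foldFin x = foldFin p ∨ orbitIndex x = orbitIndex q :=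
    ka.imp_right fun h => h.elim hfold fun h => (hfold h).trans (orbitIndex_adjacentSwap q)
  have kb' : halfFin x = halfFin p ∨ orbitIndex x = orbitIndex s :=
    kb.imp_right fun h => h.elim (orbitIndex_eq_of_halfFin_eq) fun h =>
      (orbitIndex_eq_of_halfFin_eq h).trans (orbitIndex_rev s)
  rcases ka' with ka | ka
  · rcases kb' with kb | kb
    · rw [Fin.ext_iff, foldFin_val, foldFin_val] at ka
      rw [Fin.ext_iff, halfFin_val, halfFin_val] at kb
      rw [Fin.ext_iff]
      omega
    · exact absurd ((hfold ka).symm.trans kb) h3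
  · rcases kb' with kb | kb
    · exact absurd ((orbitIndex_eq_of_halfFin_eq kb).symm.trans ka) h1
    · exact absurd (ka.symm.trans kb) h2

lemma revPerm_mem_shuffledSwapGroup {a : ℕ} (hM : 0 < M) (hn : n = 2 ^ a * M) :
    Fin.revPerm ∈ shuffledSwapGroup M n := by
  have h0 : 0 < n := by rw [hn]; positivity
  rw [← outHorseshoe_conj_blockSwapPerm_self h0]
  exact conj_mem_shuffledSwapGroup (blockSwapPerm_mem _ _ ⟨a, Or.inr hn⟩)

lemma adjacentSwap_mem_shuffledSwapGroup : adjacentSwap n ∈ shuffledSwapGroup M n :=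
  blockSwapGroup_le M n (blockSwapPerm_mem _ _ ⟨0, Or.inl rfl⟩)

lemma shuffledSwapGroup_transitive (hA : alternatingGroup (Fin (2 * n)) ≤ shuffledSwapGroup M n)
    (hn : 3 ≤ n) (hrev : Fin.revPerm ∈ shuffledSwapGroup M (2 * n)) (x y : Fin (2 * (2 * n))) :
    ∃ g ∈ shuffledSwapGroup M (2 * n), g x = y := by
  have hadj := adjacentSwap_mem_shuffledSwapGroup (M := M) (n := 2 * n)
  by_cases h : orbitIndex x = orbitIndex y
  · rcases eq_of_orbitIndex_eq h.symm with e | e | e | e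
    · exact ⟨1, one_mem _, e.symm⟩
    · exact ⟨_, hrev, e.symm⟩
    · exact ⟨_, hadj, e.symm⟩
    · exact ⟨_, mul_mem hrev hadj, e.symm⟩
  · obtain ⟨s, hs1, hs2⟩ := exists_orbitIndex hn (orbitIndex x) (orbitIndex y)
    obtain ⟨c, hc, u, v, ⟨h1, -⟩, -, hu, -⟩ := exists_cyclesTriple hA h hs2.symm hs1.symm
    rcases foldFin_eq_iff.1 hu.symm with e | e
    · exact ⟨c, hc, h1.trans e.symm⟩
    · exact ⟨_, mul_mem hrev hc, by rw [Equiv.Perm.mul_apply, h1, e]⟩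

variable {B : Set (Fin (2 * (2 * n)))}

/-- A block containing `p` and another card absorbs every three-cycle through `p`, and these reach
every mirror pair and every adjacent pair outside the orbit of `p`. -/
lemma mem_or_mem_of_isBlock (hA : alternatingGroup (Fin (2 * n)) ≤ shuffledSwapGroup M n)
    (hn : 3 ≤ n) (hB : MulAction.IsBlock (shuffledSwapGroup M (2 * n)) B)
    (hnt : B.Nontrivial) (q : Fin (2 * (2 * n))) :
    (q ∈ B ∨ Fin.revPerm q ∈ B) ∧ (q ∈ B ∨ adjacentSwap _ q ∈ B) := by
  have main : ∀ p ∈ B, ∀ q, orbitIndex p ≠ orbitIndex q →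
      (q ∈ B ∨ Fin.revPerm q ∈ B) ∧ (q ∈ B ∨ adjacentSwap _ q ∈ B) := by
    intro p hp q hpq
    obtain ⟨s, hs1, hs2⟩ := exists_orbitIndex hn (orbitIndex p) (orbitIndex q)
    constructor
    · obtain ⟨c, hc, u, v, h, -, hu, hv⟩ := exists_cyclesTriple hA hpq hs2.symm hs1.symm
      have := (h.mem_of_isBlock hB hc hp (hnt.exists_ne p)).1
      rcases foldFin_eq_iff.1 hu with rfl | rfl
      · exact Or.inl this
      · exact Or.inr this
    · obtain ⟨c, hc, u, v, h, -, hu, hv⟩ := exists_cyclesTriple hA hs1.symm hs2 hpq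
      have := (h.mem_of_isBlock hB hc hp (hnt.exists_ne p)).2
      rcases halfFin_eq_iff.1 hv with rfl | rfl
      · exact Or.inl this
      · exact Or.inr this
  obtain ⟨p, hp⟩ := hnt.nonempty
  by_cases hpq : orbitIndex p = orbitIndex q
  -- Within the orbit of `p`, restart from a card of the block in another orbit.
  · obtain ⟨s, hs1, hs2⟩ := exists_orbitIndex hn (orbitIndex p) (orbitIndex q)
    rcases (main p hp s hs1.symm).1 with h | h
    · exact main _ h q hs2
    · exact main _ h q (by rw [orbitIndex_rev]; exact hs2)
  · exact main p hp q hpq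

/-- The group moves any pair `{x, f x}` to any pair of another orbit. An element moving a pair
inside the block to a pair that meets the block preserves the block, which therefore contains the
second pair. -/
lemma eq_univ_of_isBlock_of_pair
    {f : Fin (2 * (2 * n)) → Fin (2 * (2 * n))}
    (hmove : ∀ x y, orbitIndex x ≠ orbitIndex y → ∃ g ∈ shuffledSwapGroup M (2 * n),
      (g x = y ∧ g (f x) = f y) ∨ (g x = f y ∧ g (f x) = y))
    (hn : 3 ≤ n) (hB : MulAction.IsBlock (shuffledSwapGroup M (2 * n)) B)
    (hor : ∀ q, q ∈ B ∨ f q ∈ B) {x : Fin (2 * (2 * n))} (hx : x ∈ B) (hfx : f x ∈ B) :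
    B = Set.univ := by
  have main : ∀ x ∈ B, f x ∈ B → ∀ y, orbitIndex x ≠ orbitIndex y → y ∈ B ∧ f y ∈ B := by
    intro x hx hfx y hxy
    obtain ⟨g, hg, ⟨h1, h2⟩ | ⟨h1, h2⟩⟩ := hmove x y hxy
    · rcases hor y with h | h
      · exact ⟨h, h2 ▸ apply_mem_of_isBlock hB hg hx (h1 ▸ h) hfx⟩
      · exact ⟨h1 ▸ apply_mem_of_isBlock hB hg hfx (h2 ▸ h) hx, h⟩
    · rcases hor y with h | h
      · exact ⟨h, h1 ▸ apply_mem_of_isBlock hB hg hfx (h2 ▸ h) hx⟩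
      · exact ⟨h2 ▸ apply_mem_of_isBlock hB hg hx (h1 ▸ h) hfx, h⟩
  ext y
  simp only [Set.mem_univ, iff_true]
  by_cases hxy : orbitIndex x = orbitIndex y
  · obtain ⟨s, hs1, -⟩ := exists_orbitIndex hn (orbitIndex x) 0
    obtain ⟨h1, h2⟩ := main x hx hfx s hs1.symm
    exact (main s h1 h2 y (hxy ▸ hs1)).1
  · exact (main x hx hfx y hxy).1

lemma eq_univ_of_isBlock {a : ℕ} (hA : alternatingGroup (Fin (2 * n)) ≤ shuffledSwapGroup M n)
    (hM : Odd M) (hM3 : 3 ≤ M) (hn : n = 2 ^ a * M)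
    (hB : MulAction.IsBlock (shuffledSwapGroup M (2 * n)) B) (hnt : B.Nontrivial) :
    B = Set.univ := by
  have hn2 : 2 * n = 2 ^ (a + 1) * M := by rw [hn]; ring
  have hn3 : 3 ≤ n := by
    rw [hn]; exact hM3.trans (Nat.le_mul_of_pos_left M (by positivity))
  have hrev := revPerm_mem_shuffledSwapGroup hM.pos hn2
  have hadj := adjacentSwap_mem_shuffledSwapGroup (M := M) (n := 2 * n)
  have hor := mem_or_mem_of_isBlock hA hn3 hB hnt
  by_cases hr : ∃ x ∈ B, Fin.revPerm x ∈ B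
  · obtain ⟨x, hx, hx'⟩ := hr
    refine eq_univ_of_isBlock_of_pair (f := Fin.revPerm) ?_ hn3 hB (fun q => (hor q).1) hx hx'
    intro x y hxy
    obtain ⟨z, hz⟩ : ∃ z : Fin (2 * n), z ≠ foldFin x ∧ z ≠ foldFin y := by
      obtain ⟨s, h1, h2⟩ := exists_orbitIndex hn3 (orbitIndex x) (orbitIndex y)
      refine ⟨foldFin s, ?_, ?_⟩
      · rintro e; exact h1 (congrArg (fun t : Fin (2 * n) => (t : ℕ) / 2) e)
      · rintro e; exact h2 (congrArg (fun t : Fin (2 * n) => (t : ℕ) / 2) e)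
    obtain ⟨g, hg, h1, -⟩ := exists_double_cycle hA (x := foldFin x) (y := foldFin y) (z := z)
      (fun e => hxy (congrArg (fun t : Fin (2 * n) => (t : ℕ) / 2) e)) hz.2.symm hz.1.symm
    refine ⟨g, blockSwapGroup_le _ _ hg, ?_⟩
    have k1 := foldFin_eq_iff.1 (h1 x rfl)
    have k2 := foldFin_eq_iff.1 (h1 _ (foldFin_rev x))
    have k3 : g x ≠ g (Fin.revPerm x) := fun e => by
      have := congrArg Fin.val (g.injective e)
      rw [rev_val] at this
      omega
    rcases k1 with e | e <;> rcases k2 with e' | e'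
    · exact absurd (e.trans e'.symm) k3
    · exact Or.inl ⟨e, e'⟩
    · exact Or.inr ⟨e, e'⟩
    · exact absurd (e.trans e'.symm) k3
  by_cases ha : ∃ x ∈ B, adjacentSwap _ x ∈ B
  · obtain ⟨x, hx, hx'⟩ := ha
    refine eq_univ_of_isBlock_of_pair (f := adjacentSwap (2 * n)) ?_ hn3 hB (fun q => (hor q).2) hx hx'
    intro x y hxy
    obtain ⟨z, hz⟩ : ∃ z : Fin (2 * n), z ≠ halfFin x ∧ z ≠ halfFin y := by
      obtain ⟨s, h1, h2⟩ := exists_orbitIndex hn3 (orbitIndex x) (orbitIndex y)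
      exact ⟨halfFin s, fun e => h1 (orbitIndex_eq_of_halfFin_eq e), fun e => h2 (orbitIndex_eq_of_halfFin_eq e)⟩
    obtain ⟨g, hg, h1, -⟩ := exists_double_cycle' hA (x := halfFin x) (y := halfFin y) (z := z)
      (fun e => hxy (orbitIndex_eq_of_halfFin_eq e)) hz.2.symm hz.1.symm
    refine ⟨g, hg, ?_⟩
    have k1 := halfFin_eq_iff.1 (h1 x rfl)
    have k2 := halfFin_eq_iff.1 (h1 _ (halfFin_eq_iff.2 (Or.inr rfl)))
    have k3 : g x ≠ g (adjacentSwap _ x) := fun e => by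
      have := congrArg Fin.val (g.injective e)
      rw [adjacentSwap_val] at this
      omega
    rcases k1 with e | e <;> rcases k2 with e' | e'
    · exact absurd (e.trans e'.symm) k3
    · exact Or.inl ⟨e, e'⟩
    · exact Or.inr ⟨e, e'⟩
    · exact absurd (e.trans e'.symm) k3
  -- Now the block has exactly one card in each mirror pair and in each adjacent pair: it and its
  -- complement form a two-colouring.
  push Not at hr ha
  exfalso
  refine not_twoColouring hM hM3 hn2 (B := B) ?_ ?_
  · intro g hg
    have key : ∀ g ∈ shuffledSwapGroup M (2 * n), (∃ x ∈ B, g x ∈ B) → ∀ x, g x ∈ B → x ∈ B := by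
      rintro g hg ⟨b, hb, hgb⟩ x hx
      have := apply_mem_of_isBlock hB (inv_mem hg) hgb (by rw [perm_inv_apply_self]; exact hb) hx
      rwa [perm_inv_apply_self] at this
    by_cases he : ∃ x ∈ B, g x ∈ B
    · obtain ⟨b, hb, hgb⟩ := he
      exact Or.inl fun x => ⟨key g hg ⟨b, hb, hgb⟩ x, apply_mem_of_isBlock hB hg hb hgb⟩
    · right
      intro x
      refine ⟨fun hgx hx => he ⟨x, hx, hgx⟩, fun hx => ?_⟩
      by_contra hgx
      -- If `x` and `g x` both lay outside, reversal followed by comparison at the mirror image of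
      -- `x` would show that `Fin.revPerm * g` preserves the block; as it takes `x` into the block,
      -- `x` would lie inside.
      have h1 := ((hor x).1).resolve_left hx
      have h2 := ((hor (g x)).1).resolve_left hgx
      have h3 := ((hor (g (Fin.revPerm x))).1).resolve_left (fun h => he ⟨_, h1, h⟩)
      exact hx (key (Fin.revPerm * g) (mul_mem hrev hg) ⟨_, h1, h3⟩ x h2)
  · intro x
    exact ⟨fun h hx => ha x hx h, fun h => ((hor x).2).resolve_left h⟩

/-- If the shuffled block swaps generate the alternating group of a deck, they do so for the deck
of twice the size. -/
theorem alternatingGroup_le_shuffledSwapGroup_two_mul {a : ℕ}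
    (hA : alternatingGroup (Fin (2 * n)) ≤ shuffledSwapGroup M n)
    (hM : Odd M) (hM3 : 3 ≤ M) (hn : n = 2 ^ a * M) :
    alternatingGroup (Fin (2 * (2 * n))) ≤ shuffledSwapGroup M (2 * n) := by
  have hn2 : 2 * n = 2 ^ (a + 1) * M := by rw [hn]; ring
  have hn3 : 3 ≤ n := by
    rw [hn]; exact hM3.trans (Nat.le_mul_of_pos_left M (by positivity))
  obtain ⟨q, hq, -⟩ := exists_orbitIndex hn3 0 0
  obtain ⟨s, hs, hs'⟩ := exists_orbitIndex hn3 0 (orbitIndex q)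
  have h0 : orbitIndex (⟨0, by omega⟩ : Fin (2 * (2 * n))) = 0 := by simp [orbitIndex]
  obtain ⟨c, hc, u, v, h, hne, -⟩ := exists_cyclesTriple hA (p := ⟨0, by omega⟩) (q := q) (s := s)
    (by rw [h0]; exact hq.symm) hs'.symm (by rw [h0]; exact hs.symm)
  exact alternatingGroup_le_of_blocks
    (shuffledSwapGroup_transitive hA hn3 (revPerm_mem_shuffledSwapGroup hM.pos hn2))
    (fun B hB x hx y hy hxy => eq_univ_of_isBlock hA hM hM3 hn hB ⟨x, hx, y, hy, hxy⟩)
    hc (h.isThreeCycle hne)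

end step

/-! ### Odd half-decks: an explicit product of two transpositions. -/

section odd

variable {n : ℕ}

/-- The permutation that moves even positions down by two and odd positions up by two, modulo
`2 * n`, for odd `n`. -/
def rotPerm (n : ℕ) (hn : 0 < n) : Equiv.Perm (Fin (2 * n)) :=
  (adjacentSwap n * blockSwapPerm (2 * n) n hn dvd_rfl) ^ 2

lemma blockSwapPerm_self_val (hn : 0 < n) (x : Fin (2 * n)) :
    (blockSwapPerm (2 * n) n hn dvd_rfl x : ℕ) = if (x : ℕ) < n then (x : ℕ) + n else x - n := by
  rw [blockSwapPerm_val, blockSwap, Nat.mod_eq_of_lt x.isLt]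

lemma rotPerm_val_of_even (hn : 0 < n) (ho : Odd n) {x : Fin (2 * n)} (hx : (x : ℕ) % 2 = 0) :
    (rotPerm n hn x : ℕ) = if (x : ℕ) = 0 then 2 * n - 2 else x - 2 := by
  have := x.isLt
  rw [Nat.odd_iff] at ho
  simp only [rotPerm, pow_two, Equiv.Perm.mul_apply]
  rw [adjacentSwap_val, blockSwapPerm_self_val, adjacentSwap_val, blockSwapPerm_self_val]
  split_ifs <;> omega

lemma rotPerm_val_of_odd (hn : 0 < n) (ho : Odd n) {x : Fin (2 * n)} (hx : (x : ℕ) % 2 = 1) :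
    (rotPerm n hn x : ℕ) = if (x : ℕ) = 2 * n - 1 then 1 else (x : ℕ) + 2 := by
  have := x.isLt
  rw [Nat.odd_iff] at ho
  simp only [rotPerm, pow_two, Equiv.Perm.mul_apply]
  rw [adjacentSwap_val, blockSwapPerm_self_val, adjacentSwap_val, blockSwapPerm_self_val]
  split_ifs <;> omega

lemma rotPerm_val (hn : 0 < n) (ho : Odd n) (x : Fin (2 * n)) :
    (rotPerm n hn x : ℕ) = if (x : ℕ) % 2 = 0 then (if (x : ℕ) = 0 then 2 * n - 2 else x - 2)
      else if (x : ℕ) = 2 * n - 1 then 1 else (x : ℕ) + 2 := by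
  by_cases h : (x : ℕ) % 2 = 0
  · rw [rotPerm_val_of_even hn ho h, if_pos h]
  · rw [rotPerm_val_of_odd hn ho (by omega), if_neg h]

lemma rotPerm_inv_val_of_even (hn : 0 < n) (ho : Odd n) {x : Fin (2 * n)} (hx : (x : ℕ) % 2 = 0) :
    ((rotPerm n hn)⁻¹ x : ℕ) = if (x : ℕ) = 2 * n - 2 then 0 else (x : ℕ) + 2 := by
  have hlt := x.isLt
  obtain ⟨y, rfl⟩ := (rotPerm n hn).surjective x
  rw [perm_inv_apply_self]
  rcases Nat.mod_two_eq_zero_or_one y with h | h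
  · have := rotPerm_val_of_even hn ho h
    split_ifs at this ⊢ <;> omega
  · have := rotPerm_val_of_odd hn ho h
    split_ifs at this ⊢ <;> omega

lemma rotPerm_inv_val_of_odd (hn : 0 < n) (ho : Odd n) {x : Fin (2 * n)} (hx : (x : ℕ) % 2 = 1) :
    ((rotPerm n hn)⁻¹ x : ℕ) = if (x : ℕ) = 1 then 2 * n - 1 else (x : ℕ) - 2 := by
  have hlt := x.isLt
  obtain ⟨y, rfl⟩ := (rotPerm n hn).surjective x
  rw [perm_inv_apply_self]
  rcases Nat.mod_two_eq_zero_or_one y with h | h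
  · have := rotPerm_val_of_even hn ho h
    split_ifs at this ⊢ <;> omega
  · have := rotPerm_val_of_odd hn ho h
    split_ifs at this ⊢ <;> omega

lemma rotPerm_pow_val_of_odd (hn : 0 < n) (ho : Odd n) {x : Fin (2 * n)} (hx : (x : ℕ) % 2 = 1)
    (k : ℕ) : ((rotPerm n hn ^ k) x : ℕ) = (x + 2 * k) % (2 * n) := by
  induction k with
  | zero => simp [Nat.mod_eq_of_lt x.isLt]
  | succ k ih =>
    have hlt := ((rotPerm n hn ^ k) x).isLt
    have hodd : ((rotPerm n hn ^ k) x : ℕ) % 2 = 1 := by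
      rw [ih, Nat.mod_mul_right_mod]; omega
    rw [pow_succ', Equiv.Perm.mul_apply, rotPerm_val_of_odd hn ho hodd,
      show (x : ℕ) + 2 * (k + 1) = x + 2 * k + 2 by ring, ← Nat.mod_add_mod, ← ih]
    split_ifs with h
    · rw [h, show 2 * n - 1 + 2 = 1 + 2 * n by omega, Nat.add_mod_right,
        Nat.mod_eq_of_lt (show 1 < 2 * n by omega)]
    · rw [Nat.mod_eq_of_lt (show ((rotPerm n hn ^ k) x : ℕ) + 2 < 2 * n by omega)]

lemma rotPerm_inv_val (hn : 0 < n) (ho : Odd n) (x : Fin (2 * n)) :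
    ((rotPerm n hn)⁻¹ x : ℕ) = if (x : ℕ) % 2 = 0 then
      (if (x : ℕ) = 2 * n - 2 then 0 else (x : ℕ) + 2)
      else if (x : ℕ) = 1 then 2 * n - 1 else (x : ℕ) - 2 := by
  by_cases h : (x : ℕ) % 2 = 0
  · rw [rotPerm_inv_val_of_even hn ho h, if_pos h]
  · rw [rotPerm_inv_val_of_odd hn ho (by omega), if_neg h]

/-- The conjugate of `rotPerm` under the out shuffle. -/
def shuffledRotPerm (n : ℕ) (hn : 0 < n) : Equiv.Perm (Fin (2 * n)) :=
  outHorseshoe n * rotPerm n hn * (outHorseshoe n)⁻¹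

lemma shuffledRotPerm_val (hn : 0 < n) (ho : Odd n) (hn5 : 5 ≤ n) (y : Fin (2 * n)) :
    (shuffledRotPerm n hn y : ℕ) =
      if (y : ℕ) % 4 = 0 then (if (y : ℕ) = 0 then 3 else (y : ℕ) - 4)
      else if (y : ℕ) % 4 = 1 then (if (y : ℕ) = 1 then 2 else (y : ℕ) - 4)
      else if (y : ℕ) % 4 = 2 then (if (y : ℕ) = 2 * n - 4 then 2 * n - 1 else (y : ℕ) + 4)
      else (if (y : ℕ) = 2 * n - 3 then 2 * n - 2 else (y : ℕ) + 4) := by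
  obtain ⟨x, rfl⟩ := (outHorseshoe n).surjective y
  have hx := x.isLt
  have hx' := (rotPerm n hn x).isLt
  rw [shuffledRotPerm, Equiv.Perm.mul_apply, Equiv.Perm.mul_apply, perm_inv_apply_self]
  have key := rotPerm_val hn ho x
  rw [Nat.odd_iff] at ho
  rcases lt_or_ge (x : ℕ) n with h | h
  · rw [outHorseshoe_of_lt h]
    rcases lt_or_ge (rotPerm n hn x : ℕ) n with h' | h'
    · rw [outHorseshoe_of_lt h']
      split_ifs at key <;> split_ifs <;> omega
    · rw [outHorseshoe_of_le h']
      split_ifs at key <;> split_ifs <;> omega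
  · rw [outHorseshoe_of_le h]
    rcases lt_or_ge (rotPerm n hn x : ℕ) n with h' | h'
    · rw [outHorseshoe_of_lt h']
      split_ifs at key <;> split_ifs <;> omega
    · rw [outHorseshoe_of_le h']
      split_ifs at key <;> split_ifs <;> omega

/-- A product of two transpositions in the group of shuffled block swaps. -/
def doubleTransposition (n : ℕ) (hn : 0 < n) : Equiv.Perm (Fin (2 * n)) :=
  rotPerm n hn * shuffledRotPerm n hn * (rotPerm n hn)⁻¹ * shuffledRotPerm n hn

/-- Away from the ends of the deck, `shuffledRotPerm` moves the residues 0, 1 mod 4 down by 4 and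
the residues 2, 3 up by 4. As `rotPerm` exchanges these two kinds, conjugation by it inverts
`shuffledRotPerm` up to effects at the ends, and only four cards are moved by the product. -/
lemma doubleTransposition_val (hn : 0 < n) (ho : Odd n) (hn5 : 5 ≤ n) (y : Fin (2 * n)) :
    (doubleTransposition n hn y : ℕ) = if (y : ℕ) = 1 then 2 * n - 2 else
      if (y : ℕ) = 2 * n - 2 then 1 else if (y : ℕ) = 5 then 2 * n - 3 else
      if (y : ℕ) = 2 * n - 3 then 5 else y := by
  have hy := y.isLt
  simp only [doubleTransposition, Equiv.Perm.mul_apply]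
  have e1 := shuffledRotPerm_val hn ho hn5 y
  generalize shuffledRotPerm n hn y = u at *
  have hu := u.isLt
  have e2 := rotPerm_inv_val hn ho u
  generalize (rotPerm n hn)⁻¹ u = v at *
  have hv := v.isLt
  have e3 := shuffledRotPerm_val hn ho hn5 v
  generalize shuffledRotPerm n hn v = w at *
  have hw := w.isLt
  have e4 := rotPerm_val hn ho w
  generalize rotPerm n hn w = z at *
  rw [Nat.odd_iff] at ho
  have hcases : ((y : ℕ) = 0) ∨
      ((y : ℕ) = 2 * n - 2) ∨
      ((y : ℕ) % 4 = 0 ∧ (y : ℕ) ≠ 0 ∧ (y : ℕ) ≠ 2 * n - 2) ∨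
      ((y : ℕ) = 1) ∨
      ((y : ℕ) = 5) ∨
      ((y : ℕ) % 4 = 1 ∧ (y : ℕ) ≠ 1 ∧ (y : ℕ) ≠ 5) ∨
      ((y : ℕ) = 2 * n - 4) ∨
      ((y : ℕ) % 4 = 2 ∧ (y : ℕ) ≠ 2 * n - 4) ∨
      ((y : ℕ) = 2 * n - 3) ∨
      ((y : ℕ) % 4 = 3 ∧ (y : ℕ) ≠ 2 * n - 3) := by omega
  rcases hcases with h | h | h | h | h | h | h | h | h | h
  · have k1 : (u : ℕ) = 3 := by clear e2 e3 e4; split_ifs at e1 <;> omega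
    have k2 : (v : ℕ) = 1 := by clear e1 e3 e4; split_ifs at e2 <;> omega
    have k3 : (w : ℕ) = 2 := by clear e1 e2 e4; split_ifs at e3 <;> omega
    have k4 : (z : ℕ) = 0 := by clear e1 e2 e3; split_ifs at e4 <;> omega
    clear e1 e2 e3 e4; split_ifs <;> omega
  · have k1 : (u : ℕ) = 2 * n - 6 := by clear e2 e3 e4; split_ifs at e1 <;> omega
    have k2 : (v : ℕ) = 2 * n - 4 := by clear e1 e3 e4; split_ifs at e2 <;> omega
    have k3 : (w : ℕ) = 2 * n - 1 := by clear e1 e2 e4; split_ifs at e3 <;> omega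
    have k4 : (z : ℕ) = 1 := by clear e1 e2 e3; split_ifs at e4 <;> omega
    clear e1 e2 e3 e4; split_ifs <;> omega
  · have k1 : (u : ℕ) = (y : ℕ) - 4 := by clear e2 e3 e4; split_ifs at e1 <;> omega
    have k2 : (v : ℕ) = (y : ℕ) - 2 := by clear e1 e3 e4; split_ifs at e2 <;> omega
    have k3 : (w : ℕ) = (y : ℕ) + 2 := by clear e1 e2 e4; split_ifs at e3 <;> omega
    have k4 : (z : ℕ) = (y : ℕ) := by clear e1 e2 e3; split_ifs at e4 <;> omega
    clear e1 e2 e3 e4; split_ifs <;> omega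
  · have k1 : (u : ℕ) = 2 := by clear e2 e3 e4; split_ifs at e1 <;> omega
    have k2 : (v : ℕ) = 4 := by clear e1 e3 e4; split_ifs at e2 <;> omega
    have k3 : (w : ℕ) = 0 := by clear e1 e2 e4; split_ifs at e3 <;> omega
    have k4 : (z : ℕ) = 2 * n - 2 := by clear e1 e2 e3; split_ifs at e4 <;> omega
    clear e1 e2 e3 e4; split_ifs <;> omega
  · have k1 : (u : ℕ) = 1 := by clear e2 e3 e4; split_ifs at e1 <;> omega
    have k2 : (v : ℕ) = 2 * n - 1 := by clear e1 e3 e4; split_ifs at e2 <;> omega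
    have k3 : (w : ℕ) = 2 * n - 5 := by clear e1 e2 e4; split_ifs at e3 <;> omega
    have k4 : (z : ℕ) = 2 * n - 3 := by clear e1 e2 e3; split_ifs at e4 <;> omega
    clear e1 e2 e3 e4; split_ifs <;> omega
  · have k1 : (u : ℕ) = (y : ℕ) - 4 := by clear e2 e3 e4; split_ifs at e1 <;> omega
    have k2 : (v : ℕ) = (y : ℕ) - 6 := by clear e1 e3 e4; split_ifs at e2 <;> omega
    have k3 : (w : ℕ) = (y : ℕ) - 2 := by clear e1 e2 e4; split_ifs at e3 <;> omega
    have k4 : (z : ℕ) = (y : ℕ) := by clear e1 e2 e3; split_ifs at e4 <;> omega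
    clear e1 e2 e3 e4; split_ifs <;> omega
  · have k1 : (u : ℕ) = 2 * n - 1 := by clear e2 e3 e4; split_ifs at e1 <;> omega
    have k2 : (v : ℕ) = 2 * n - 3 := by clear e1 e3 e4; split_ifs at e2 <;> omega
    have k3 : (w : ℕ) = 2 * n - 2 := by clear e1 e2 e4; split_ifs at e3 <;> omega
    have k4 : (z : ℕ) = 2 * n - 4 := by clear e1 e2 e3; split_ifs at e4 <;> omega
    clear e1 e2 e3 e4; split_ifs <;> omega
  · have k1 : (u : ℕ) = (y : ℕ) + 4 := by clear e2 e3 e4; split_ifs at e1 <;> omega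
    have k2 : (v : ℕ) = (y : ℕ) + 6 := by clear e1 e3 e4; split_ifs at e2 <;> omega
    have k3 : (w : ℕ) = (y : ℕ) + 2 := by clear e1 e2 e4; split_ifs at e3 <;> omega
    have k4 : (z : ℕ) = (y : ℕ) := by clear e1 e2 e3; split_ifs at e4 <;> omega
    clear e1 e2 e3 e4; split_ifs <;> omega
  · have k1 : (u : ℕ) = 2 * n - 2 := by clear e2 e3 e4; split_ifs at e1 <;> omega
    have k2 : (v : ℕ) = 0 := by clear e1 e3 e4; split_ifs at e2 <;> omega
    have k3 : (w : ℕ) = 3 := by clear e1 e2 e4; split_ifs at e3 <;> omega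
    have k4 : (z : ℕ) = 5 := by clear e1 e2 e3; split_ifs at e4 <;> omega
    clear e1 e2 e3 e4; split_ifs <;> omega
  · have k1 : (u : ℕ) = (y : ℕ) + 4 := by clear e2 e3 e4; split_ifs at e1 <;> omega
    have k2 : (v : ℕ) = (y : ℕ) + 2 := by clear e1 e3 e4; split_ifs at e2 <;> omega
    have k3 : (w : ℕ) = (y : ℕ) - 2 := by clear e1 e2 e4; split_ifs at e3 <;> omega
    have k4 : (z : ℕ) = (y : ℕ) := by clear e1 e2 e3; split_ifs at e4 <;> omega
    clear e1 e2 e3 e4; split_ifs <;> omega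

end odd

/-! ### Odd half-decks: three-cycle and primitivity. -/

section odd

variable {n : ℕ}

lemma CyclesTriple.conj {α : Type*} {c : Equiv.Perm α} {p q r : α} (h : CyclesTriple c p q r)
    (g : Equiv.Perm α) : CyclesTriple (g * c * g⁻¹) (g p) (g q) (g r) := by
  obtain ⟨h1, h2, h3, h4⟩ := h
  simp only [CyclesTriple, Equiv.Perm.mul_apply, perm_inv_apply_self, h1, h2, h3, true_and]
  intro x
  obtain ⟨y, rfl⟩ := g.surjective x
  rw [perm_inv_apply_self]
  intro k1 k2 k3
  rw [h4 y (fun e => k1 (e ▸ rfl)) (fun e => k2 (e ▸ rfl)) (fun e => k3 (e ▸ rfl))]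

lemma rotPerm_mem (hn : 0 < n) : rotPerm n hn ∈ blockSwapGroup n (2 * n) :=
  pow_mem (mul_mem (blockSwapPerm_mem _ _ ⟨0, Or.inl rfl⟩)
    (blockSwapPerm_mem _ _ ⟨0, Or.inr (one_mul n).symm⟩)) 2

lemma doubleTransposition_mem (hn : 0 < n) : doubleTransposition n hn ∈ shuffledSwapGroup n n := by
  have h1 := blockSwapGroup_le n n (rotPerm_mem hn)
  have h2 : shuffledRotPerm n hn ∈ _ := conj_mem_shuffledSwapGroup (rotPerm_mem hn)
  exact mul_mem (mul_mem (mul_mem h1 h2) (inv_mem h1)) h2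

lemma mod_eq_or {x m : ℕ} (h : x < 2 * m) : x % m = x ∧ x < m ∨ x % m = x - m ∧ m ≤ x := by
  rcases lt_or_ge x m with h' | h'
  · exact Or.inl ⟨Nat.mod_eq_of_lt h', h'⟩
  · right
    rw [Nat.mod_eq_sub_mod h', Nat.mod_eq_of_lt (by omega)]
    exact ⟨rfl, h'⟩

/-- The group of shuffled block swaps contains a three-cycle through `5` and its image `13` under
the fourth power of `rotPerm`. -/
lemma exists_cyclesTriple_five (hn : 0 < n) (ho : Odd n) (hn5 : 5 ≤ n) :
    ∃ c ∈ shuffledSwapGroup n n, ∃ q : Fin (2 * n), (⟨5, by omega⟩ : Fin (2 * n)) ≠ q ∧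
      CyclesTriple c ⟨5, by omega⟩ q ((rotPerm n hn ^ 4) ⟨5, by omega⟩) := by
  have hF := doubleTransposition_val hn ho hn5
  have hR4 : ∀ x : Fin (2 * n), (x : ℕ) % 2 = 1 →
      ((rotPerm n hn ^ 4) x : ℕ) = (x + 8) % (2 * n) :=
    fun x hx => rotPerm_pow_val_of_odd hn ho hx 4
  have hr4 := pow_mem (blockSwapGroup_le n n (rotPerm_mem hn)) 4
  have hd := doubleTransposition_mem hn
  set F := doubleTransposition n hn
  set R := rotPerm n hn ^ 4 with hR
  have hb : ∀ x, (R * F * R⁻¹) (R x) = R (F x) := fun x => by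
    rw [Equiv.Perm.mul_apply, Equiv.Perm.mul_apply, perm_inv_apply_self]
  have hgm : R * F * R⁻¹ ∈ shuffledSwapGroup n n := mul_mem (mul_mem hr4 hd) (inv_mem hr4)
  have hn2 := Nat.odd_iff.1 ho
  have hpar : ∀ x : Fin (2 * n), (R x : ℕ) % 2 = (x : ℕ) % 2 := by
    have h1 : ∀ x : Fin (2 * n), (rotPerm n hn x : ℕ) % 2 = (x : ℕ) % 2 := fun x => by
      have := rotPerm_val hn ho x
      split_ifs at this <;> omega
    intro x
    rw [hR]
    simp only [pow_succ, pow_zero, one_mul, Equiv.Perm.mul_apply, h1]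
  -- The only even position moved by `F` is `2 * n - 2`, and `R` moves it away; so the supports of
  -- `F` and its conjugate share no even position.
  have hlast : ∀ x : Fin (2 * n), (x : ℕ) = 2 * n - 2 → (R x : ℕ) ≠ 2 * n - 2 := by
    intro x hx
    rw [hR]
    simp only [pow_succ, pow_zero, one_mul, Equiv.Perm.mul_apply]
    have h1 : ∀ y : Fin (2 * n), (y : ℕ) % 2 = 0 → 2 ≤ (y : ℕ) → (rotPerm n hn y : ℕ) = y - 2 :=
      fun y h2 h3 => by rw [rotPerm_val_of_even hn ho h2, if_neg (by omega)]
    have k1 := h1 x (by omega) (by omega)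
    have k2 := h1 _ (by omega) (by omega : 2 ≤ (rotPerm n hn x : ℕ))
    have k3 := h1 _ (by omega) (by omega : 2 ≤ (rotPerm n hn (rotPerm n hn x) : ℕ))
    have k4 := h1 _ (by omega) (by omega : 2 ≤ (rotPerm n hn (rotPerm n hn (rotPerm n hn x)) : ℕ))
    omega
  have hsupp : ∀ x : Fin (2 * n), F x ≠ x →
      (x : ℕ) = 1 ∨ (x : ℕ) = 2 * n - 2 ∨ (x : ℕ) = 5 ∨ (x : ℕ) = 2 * n - 3 := by
    intro x hx
    rw [Ne, Fin.ext_iff, hF] at hx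
    split_ifs at hx <;> omega
  -- The fourth power is chosen because it shifts odd positions by 8 and so takes `2 * n - 3` to 5,
  -- making the two supports meet there.
  have hR3 : R ⟨2 * n - 3, by omega⟩ = ⟨5, by omega⟩ := by
    rw [Fin.ext_iff, hR4 _ (by dsimp only; omega)]
    dsimp only
    rw [show 2 * n - 3 + 8 = 5 + 2 * n by omega, Nat.add_mod_right, Nat.mod_eq_of_lt (by omega)]
  have hF5 : F ⟨2 * n - 3, by omega⟩ = ⟨5, by omega⟩ := by
    rw [Fin.ext_iff, hF]
    dsimp only
    split_ifs <;> omega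
  have hF5' : F ⟨5, by omega⟩ = ⟨2 * n - 3, by omega⟩ := by
    rw [Fin.ext_iff, hF]
    dsimp only
    split_ifs <;> omega
  have hb5 : (R * F * R⁻¹) ⟨5, by omega⟩ = R ⟨5, by omega⟩ := by
    have := hb ⟨2 * n - 3, by omega⟩
    rwa [hR3, hF5] at this
  have := cyclesTriple_commutator (a := F) (b := R * F * R⁻¹) (p := ⟨5, by omega⟩)
    (by rw [hF5', Ne, Fin.ext_iff]; dsimp only; omega)
    (by
      rw [hb5, Ne, Fin.ext_iff, hR4 _ (by dsimp only)]
      dsimp only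
      rcases mod_eq_or (x := 5 + 8) (m := 2 * n) (by omega) with h | h <;> omega)
    (by
      intro x hax hbx
      obtain ⟨y, rfl⟩ := R.surjective x
      rw [hb] at hbx
      have hy : F y ≠ y := fun e => hbx (by rw [e])
      have h1 := hsupp _ hax
      have h2 := hsupp _ hy
      have h3 := hpar y
      have h4 := hlast y
      have hylt := y.isLt
      rw [Fin.ext_iff]
      dsimp only
      rcases Nat.mod_two_eq_zero_or_one y with hp | hp
      · exfalso; exact h4 (by omega) (by omega)
      · have h5 := hR4 y hp
        rcases mod_eq_or (x := (y : ℕ) + 8) (m := 2 * n) (by omega) with h | h <;> omega)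
  rw [hF5', hb5] at this
  exact ⟨_, mul_mem (mul_mem (mul_mem hd hgm) (inv_mem hd)) (inv_mem hgm), _,
    by rw [Ne, Fin.ext_iff]; dsimp only; omega, this⟩

lemma exists_apply_five_eq (hn : 0 < n) (ho : Odd n) (hn5 : 5 ≤ n) (x : Fin (2 * n)) :
    ∃ g ∈ shuffledSwapGroup n n, g ⟨5, by omega⟩ = x ∧
      (g ((rotPerm n hn ^ 4) ⟨5, by omega⟩) : ℕ) = (x + 8) % (2 * n) := by
  have hr := blockSwapGroup_le n n (rotPerm_mem hn)
  have hodd : ∀ x : Fin (2 * n), (x : ℕ) % 2 = 1 → ∃ k, (rotPerm n hn ^ k) ⟨5, by omega⟩ = x := by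
    intro x hx
    refine ⟨(x + 2 * n - 5) / 2, ?_⟩
    rw [Fin.ext_iff, rotPerm_pow_val_of_odd hn ho (by dsimp only)]
    dsimp only
    rw [show 5 + 2 * (((x : ℕ) + 2 * n - 5) / 2) = x + 2 * n by omega, Nat.add_mod_right,
      Nat.mod_eq_of_lt x.isLt]
  have hcomm : ∀ k, (rotPerm n hn ^ k) ((rotPerm n hn ^ 4) ⟨5, by omega⟩) =
      (rotPerm n hn ^ 4) ((rotPerm n hn ^ k) ⟨5, by omega⟩) := fun k => by
    rw [← Equiv.Perm.mul_apply, ← Equiv.Perm.mul_apply, ← pow_add, ← pow_add, add_comm]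
  rcases Nat.mod_two_eq_zero_or_one x with hx | hx
  · have hlt := x.isLt
    obtain ⟨k, hk⟩ := hodd (adjacentSwap n x) (by rw [adjacentSwap_val]; omega)
    refine ⟨adjacentSwap n * rotPerm n hn ^ k,
      mul_mem adjacentSwap_mem_shuffledSwapGroup (pow_mem hr k), ?_, ?_⟩
    · rw [Equiv.Perm.mul_apply, hk, Fin.ext_iff, adjacentSwap_val, adjacentSwap_val]
      omega
    · rw [Equiv.Perm.mul_apply, hcomm, hk, adjacentSwap_val,
        rotPerm_pow_val_of_odd hn ho (by rw [adjacentSwap_val]; omega), adjacentSwap_val]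
      rcases mod_eq_or (x := (x : ℕ) + 8) (m := 2 * n) (by omega) with h | h <;>
      rcases mod_eq_or (x := (x : ℕ) / 2 * 2 + (1 - (x : ℕ) % 2) + 2 * 4) (m := 2 * n) (by omega)
        with h' | h' <;> omega
  · obtain ⟨k, hk⟩ := hodd x hx
    refine ⟨rotPerm n hn ^ k, pow_mem hr k, hk, ?_⟩
    rw [hcomm, hk, rotPerm_pow_val_of_odd hn ho hx]

/-- The shuffled block swaps generate the alternating group if the half deck has an odd number
`n ≥ 5` of cards. -/
theorem alternatingGroup_le_shuffledSwapGroup_of_odd (ho : Odd n) (hn5 : 5 ≤ n) :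
    alternatingGroup (Fin (2 * n)) ≤ shuffledSwapGroup n n := by
  have hn : 0 < n := by omega
  have hn2 := Nat.odd_iff.1 ho
  obtain ⟨c, hc, q, hne, h⟩ := exists_cyclesTriple_five hn ho hn5
  refine alternatingGroup_le_of_blocks ?_ ?_ hc (h.isThreeCycle hne)
  · intro x y
    obtain ⟨g, hg, h1, -⟩ := exists_apply_five_eq hn ho hn5 x
    obtain ⟨g', hg', h1', -⟩ := exists_apply_five_eq hn ho hn5 y
    refine ⟨g' * g⁻¹, mul_mem hg' (inv_mem hg), ?_⟩
    rw [← h1, Equiv.Perm.mul_apply, perm_inv_apply_self, h1']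
  intro B hB x hx y hy hxy
  have hnt : B.Nontrivial := ⟨x, hx, y, hy, hxy⟩
  -- Conjugates of the three-cycle pass through every `x` together with `x + 8` modulo `2 * n`.
  have hadd : ∀ x ∈ B, ∀ k, ∃ y ∈ B, (y : ℕ) = (x + 8 * k) % (2 * n) := by
    intro x hx k
    induction k with
    | zero => exact ⟨x, hx, by simp [Nat.mod_eq_of_lt x.isLt]⟩
    | succ k ih =>
      obtain ⟨y, hy, hyk⟩ := ih
      obtain ⟨g, hg, h1, h2⟩ := exists_apply_five_eq hn ho hn5 y
      have h3 := h.conj g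
      rw [h1] at h3
      refine ⟨_, (h3.mem_of_isBlock hB (mul_mem (mul_mem hg hc) (inv_mem hg)) hy
        (hnt.exists_ne y)).2, ?_⟩
      rw [h2, hyk, Nat.mod_add_mod]
      congr 1
  have hpar : ∀ x ∈ B, ∀ y : Fin (2 * n), (x : ℕ) % 2 = (y : ℕ) % 2 → y ∈ B := by
    intro x hx y hxy
    have hlt := x.isLt
    obtain ⟨d, hd⟩ : ∃ d, (y : ℕ) + 2 * n = x + 2 * d := ⟨(y + 2 * n - x) / 2, by omega⟩
    -- `m` inverts 2 modulo `n`, so `d * m * m` steps of length 8 amount to a shift by `2 * d`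
    -- modulo `2 * n`.
    obtain ⟨m, hm⟩ : ∃ m, n + 1 = 2 * m := ⟨(n + 1) / 2, by omega⟩
    obtain ⟨z, hz, hzk⟩ := hadd x hx (d * (m * m))
    have h1 : (x : ℕ) + 8 * (d * (m * m)) = y + 2 * n * (1 + d * (n + 2)) := by
      have h2 : 8 * (d * (m * m)) = 2 * d * ((2 * m) * (2 * m)) := by ring
      rw [h2, ← hm]
      have h3 : 2 * d * ((n + 1) * (n + 1)) = 2 * d + 2 * n * (d * (n + 2)) := by ring
      rw [h3, show 2 * n * (1 + d * (n + 2)) = 2 * n + 2 * n * (d * (n + 2)) by ring]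
      omega
    rw [h1, Nat.add_mul_mod_self_left, Nat.mod_eq_of_lt y.isLt] at hzk
    rwa [← Fin.ext hzk]
  have hF := doubleTransposition_val hn ho hn5
  have hd := doubleTransposition_mem hn
  -- The double transposition mixes parities: it fixes 0 but sends `2 * n - 2` to 1, and it keeps 5
  -- odd but sends 1 to `2 * n - 2`.
  obtain ⟨u, hu, v, hv, huv⟩ : ∃ u ∈ B, ∃ v ∈ B, (u : ℕ) % 2 ≠ (v : ℕ) % 2 := by
    rcases Nat.mod_two_eq_zero_or_one x with hx2 | hx2
    · have h0 : (⟨0, by omega⟩ : Fin (2 * n)) ∈ B := hpar x hx _ (by dsimp only; omega)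
      have h1 : (⟨2 * n - 2, by omega⟩ : Fin (2 * n)) ∈ B := hpar x hx _ (by dsimp only; omega)
      refine ⟨_, h0, _, apply_mem_of_isBlock hB hd h0 (hpar x hx _ ?_) h1, ?_⟩
      · rw [hF]; dsimp only; split_ifs <;> omega
      · rw [hF]; dsimp only; split_ifs <;> omega
    · have h0 : (⟨5, by omega⟩ : Fin (2 * n)) ∈ B := hpar x hx _ (by dsimp only; omega)
      have h1 : (⟨1, by omega⟩ : Fin (2 * n)) ∈ B := hpar x hx _ (by dsimp only; omega)
      refine ⟨_, h0, _, apply_mem_of_isBlock hB hd h0 (hpar x hx _ ?_) h1, ?_⟩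
      · rw [hF]; dsimp only; split_ifs <;> omega
      · rw [hF]; dsimp only; split_ifs <;> omega
  ext w
  simp only [Set.mem_univ, iff_true]
  by_cases huw : (u : ℕ) % 2 = (w : ℕ) % 2
  · exact hpar u hu w huw
  · exact hpar v hv w (by omega)

end odd

/-! ### The deck of 24 cards. -/

section deck24

/-- The block swaps of a deck of 24 cards. -/
def swap24 (B : ℕ) (hB : 0 < B := by decide) (hL : 2 * B ∣ 2 * 12 := by decide) :
    Equiv.Perm (Fin (2 * 12)) := blockSwapPerm (2 * 12) B hB hL

/-- A shuffled block swap of a deck of 24 cards. -/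
def shuffledSwap24 : Equiv.Perm (Fin (2 * 12)) :=
  outHorseshoe 12 * swap24 4 * (outHorseshoe 12)⁻¹

/-- A three-cycle generated by shuffled block swaps of a deck of 24 cards. -/
def threeCycle24 : Equiv.Perm (Fin (2 * 12)) :=
  (swap24 2 * swap24 3 * shuffledSwap24 * swap24 6) ^ 14

/-- A cycle of length 23 generated by shuffled block swaps of a deck of 24 cards. -/
def longCycle24 : Equiv.Perm (Fin (2 * 12)) :=
  swap24 1 * swap24 4 * swap24 3 * swap24 12 * shuffledSwap24 * swap24 6

/-- The word has one cycle of length 3, and its other cycle lengths divide 14. -/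
lemma isThreeCycle_threeCycle24 : threeCycle24.IsThreeCycle :=
  card_support_eq_three_iff.1 (by decide +kernel)

lemma longCycle24_zero : longCycle24 0 = 0 := by decide +kernel

lemma exists_longCycle24_pow : ∀ z : Fin (2 * 12), z ≠ 0 → ∃ k : Fin 23,
    (longCycle24 ^ (k : ℕ)) 1 = z := by decide +kernel

lemma swap24_one_zero : swap24 1 (by decide) (by decide) 0 = 1 := by decide +kernel

/-- The shuffled block swaps generate the alternating group of a deck of 24 cards. -/
theorem alternatingGroup_le_shuffledSwapGroup_twelve :
    alternatingGroup (Fin (2 * 12)) ≤ shuffledSwapGroup 3 12 := by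
  have hmem : ∀ {B : ℕ} (hB : 0 < B) (hL : 2 * B ∣ 2 * 12), IsBlockLength 3 B →
      swap24 B hB hL ∈ blockSwapGroup 3 (2 * 12) := fun hB hL h => blockSwapPerm_mem hB hL h
  have hle := blockSwapGroup_le 3 12
  have h1 := hmem (B := 1) (by decide) (by decide) ⟨0, Or.inl rfl⟩
  have h2 := hmem (B := 2) (by decide) (by decide) ⟨1, Or.inl rfl⟩
  have h4 := hmem (B := 4) (by decide) (by decide) ⟨2, Or.inl rfl⟩
  have h3 := hmem (B := 3) (by decide) (by decide) ⟨0, Or.inr rfl⟩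
  have h6 := hmem (B := 6) (by decide) (by decide) ⟨1, Or.inr rfl⟩
  have h12 := hmem (B := 12) (by decide) (by decide) ⟨2, Or.inr rfl⟩
  have hT : shuffledSwap24 ∈ shuffledSwapGroup 3 12 := conj_mem_shuffledSwapGroup h4
  have hc : threeCycle24 ∈ shuffledSwapGroup 3 12 :=
    pow_mem (mul_mem (mul_mem (mul_mem (hle h2) (hle h3)) hT) (hle h6)) 14
  have hl : longCycle24 ∈ shuffledSwapGroup 3 12 :=
    mul_mem (mul_mem (mul_mem (mul_mem (mul_mem (hle h1) (hle h4)) (hle h3)) (hle h12)) hT) (hle h6)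
  have hfix : ∀ k : ℕ, (longCycle24 ^ k) 0 = 0 := fun k => by
    induction k with
    | zero => rfl
    | succ k ih => rw [pow_succ, Equiv.Perm.mul_apply, longCycle24_zero, ih]
  have hzero : ∀ x, ∃ g ∈ shuffledSwapGroup 3 12, g 0 = x := by
    intro x
    by_cases hx : x = 0
    · exact ⟨1, one_mem _, hx.symm⟩
    · obtain ⟨k, hk⟩ := exists_longCycle24_pow x hx
      exact ⟨longCycle24 ^ (k : ℕ) * swap24 1, mul_mem (pow_mem hl _) (hle h1), by
        rw [Equiv.Perm.mul_apply, swap24_one_zero, hk]⟩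
  refine alternatingGroup_le_of_blocks ?_ ?_ hc isThreeCycle_threeCycle24
  · intro x y
    obtain ⟨g, hg, rfl⟩ := hzero x
    obtain ⟨g', hg', rfl⟩ := hzero y
    exact ⟨g' * g⁻¹, mul_mem hg' (inv_mem hg), by rw [Equiv.Perm.mul_apply, perm_inv_apply_self]⟩
  · intro B hB x hx y hy hxy
    obtain ⟨g, hg, rfl⟩ := hzero x
    obtain ⟨y, rfl⟩ := g.surjective y
    ext z
    simp only [Set.mem_univ, iff_true]
    obtain ⟨z, rfl⟩ := g.surjective z
    by_cases hz : z = 0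
    · rwa [hz]
    obtain ⟨i, hi⟩ := exists_longCycle24_pow y (fun e => hxy (by rw [e]))
    obtain ⟨j, hj⟩ := exists_longCycle24_pow z hz
    -- The long cycle fixes 0 and is transitive on the other cards, so the group is doubly
    -- transitive; its conjugates by `g` preserve the block because they fix `g 0`.
    have hk : ∀ k : ℕ, ∀ w, g w ∈ B → g ((longCycle24 ^ k) w) ∈ B := fun k w hw => by
      have := apply_mem_of_isBlock hB (g := g * longCycle24 ^ k * g⁻¹)
        (mul_mem (mul_mem hg (pow_mem hl k)) (inv_mem hg)) hx
        (by rwa [Equiv.Perm.mul_apply, Equiv.Perm.mul_apply, perm_inv_apply_self, hfix]) hw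
      rwa [Equiv.Perm.mul_apply, Equiv.Perm.mul_apply, perm_inv_apply_self] at this
    have hk' : ∀ w, g w ∈ B → g ((longCycle24 ^ (i : ℕ))⁻¹ w) ∈ B := fun w hw => by
      have := apply_mem_of_isBlock hB (g := g * (longCycle24 ^ (i : ℕ))⁻¹ * g⁻¹)
        (mul_mem (mul_mem hg (inv_mem (pow_mem hl _))) (inv_mem hg)) hx
        (by
          have h0 : (longCycle24 ^ (i : ℕ))⁻¹ 0 = 0 := by
            conv_lhs => rw [← hfix i, perm_inv_apply_self]
          rwa [Equiv.Perm.mul_apply, Equiv.Perm.mul_apply, perm_inv_apply_self, h0]) hw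
      rwa [Equiv.Perm.mul_apply, Equiv.Perm.mul_apply, perm_inv_apply_self] at this
    have h5 := hk' y hy
    rw [← hi, perm_inv_apply_self] at h5
    have h6 := hk j 1 h5
    rwa [hj] at h6

end deck24

/-- For decks of `2 * n = 2 ^ (a + 1) * M` cards, `M ≥ 3` odd, the shuffled block swaps generate
the alternating group, except for decks of 6 and 12 cards. -/
theorem alternatingGroup_le_shuffledSwapGroup {M : ℕ} (hM : Odd M) (hM3 : 3 ≤ M) (a : ℕ)
    (h : M = 3 → 2 ≤ a) :
    alternatingGroup (Fin (2 * (2 ^ a * M))) ≤ shuffledSwapGroup M (2 ^ a * M) := by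
  have step : ∀ a, alternatingGroup (Fin (2 * (2 ^ a * M))) ≤ shuffledSwapGroup M (2 ^ a * M) →
      alternatingGroup (Fin (2 * (2 ^ (a + 1) * M))) ≤ shuffledSwapGroup M (2 ^ (a + 1) * M) := by
    intro a ih
    rw [show 2 ^ (a + 1) * M = 2 * (2 ^ a * M) by ring]
    exact alternatingGroup_le_shuffledSwapGroup_two_mul ih hM hM3 rfl
  -- The doubling starts from 24 cards if `M = 3`, and from `2 * M` cards otherwise.
  by_cases h3 : M = 3
  · subst h3
    induction a, h rfl using Nat.le_induction with
    | base => exact alternatingGroup_le_shuffledSwapGroup_twelve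
    | succ a ha ih => exact step a (ih fun _ => ha)
  · induction a with
    | zero =>
      rw [pow_zero, one_mul]
      refine alternatingGroup_le_shuffledSwapGroup_of_odd hM ?_
      rw [Nat.odd_iff] at hM
      omega
    | succ a ih => exact step a (ih fun e => absurd e h3)

/-! ### Signs of the shuffles. -/

/-- Count inversions of the shuffled deck: the card in an even position is smaller than all later
cards, the one in an odd position `i` is larger than all of the `2 * n - 1 - i` later cards, an even
number. -/
lemma sign_outHorseshoe (n : ℕ) : (outHorseshoe n).sign = 1 := by
  rw [← Equiv.Perm.sign_inv, Equiv.Perm.sign_eq_prod_prod_Ioi]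
  have hval : ∀ j : Fin (2 * n), ((outHorseshoe n)⁻¹ j : ℕ) =
      if (j : ℕ) % 2 = 0 then (j : ℕ) / 2 else 2 * n - 1 - (j : ℕ) / 2 := fun j => rfl
  refine Finset.prod_eq_one fun i _ => ?_
  have hi := i.isLt
  rcases Nat.mod_two_eq_zero_or_one i with h | h
  · refine Finset.prod_eq_one fun j hj => if_pos ?_
    have hj' : (i : ℕ) < j := Fin.lt_def.1 (Finset.mem_Ioi.1 hj)
    have hj'' := j.isLt
    rw [Fin.lt_def, hval, hval]
    split_ifs <;> omega
  · have : ∀ j ∈ Finset.Ioi i, (if (outHorseshoe n)⁻¹ i < (outHorseshoe n)⁻¹ j then (1 : ℤˣ) else -1)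
        = -1 := by
      intro j hj
      refine if_neg ?_
      have hj' : (i : ℕ) < j := Fin.lt_def.1 (Finset.mem_Ioi.1 hj)
      have hj'' := j.isLt
      rw [Fin.lt_def, hval, hval]
      split_ifs <;> omega
    rw [Finset.prod_congr rfl this, Finset.prod_const, Fin.card_Ioi]
    exact Even.neg_one_pow (by rw [Nat.even_iff]; omega)

lemma adjacentSwap_mul_outHorseshoe (n : ℕ) : adjacentSwap n * outHorseshoe n = inHorseshoe n := by
  ext x
  have := x.isLt
  rw [Equiv.Perm.mul_apply, adjacentSwap_val]
  rcases lt_or_ge (x : ℕ) n with h | h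
  · rw [outHorseshoe_of_lt h, inHorseshoe_of_lt h]; omega
  · rw [outHorseshoe_of_le h, inHorseshoe_of_le h]; omega

lemma sign_adjacentSwap (n : ℕ) : (adjacentSwap n).sign = (-1) ^ n := by
  have hinv : ∀ x, adjacentSwap n (adjacentSwap n x) = x := fun x => by
    rw [Fin.ext_iff, adjacentSwap_val, adjacentSwap_val]; omega
  rw [Equiv.Perm.sign_eq_prod_prod_Ioi]
  have hrow : ∀ i : Fin (2 * n), (∏ j ∈ Finset.Ioi i,
      if adjacentSwap n i < adjacentSwap n j then (1 : ℤˣ) else -1) =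
      if (i : ℕ) % 2 = 0 then -1 else 1 := by
    intro i
    have hi := i.isLt
    split_ifs with h
    · rw [Finset.prod_eq_single (adjacentSwap n i)]
      · refine if_neg ?_
        rw [hinv, Fin.lt_def, adjacentSwap_val]; omega
      · intro j hj hne
        refine if_pos ?_
        have hj' : (i : ℕ) < j := Fin.lt_def.1 (Finset.mem_Ioi.1 hj)
        rw [Ne, Fin.ext_iff, adjacentSwap_val] at hne
        rw [Fin.lt_def, adjacentSwap_val, adjacentSwap_val]; omega
      · intro hj
        exfalso
        refine hj (Finset.mem_Ioi.2 ?_)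
        rw [Fin.lt_def, adjacentSwap_val]; omega
    · refine Finset.prod_eq_one fun j hj => if_pos ?_
      have hj' : (i : ℕ) < j := Fin.lt_def.1 (Finset.mem_Ioi.1 hj)
      rw [Fin.lt_def, adjacentSwap_val, adjacentSwap_val]; omega
  rw [Finset.prod_congr rfl fun i _ => hrow i,
    Fin.prod_univ_eq_prod_range (fun i => if i % 2 = 0 then (-1 : ℤˣ) else 1) (2 * n)]
  clear hrow hinv
  induction n with
  | zero => simp
  | succ n ih =>
    rw [mul_add, mul_one, Finset.prod_range_succ, Finset.prod_range_succ, ih, if_pos (by omega),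
      if_neg (by omega), mul_one, pow_succ]

lemma sign_inHorseshoe (n : ℕ) : (inHorseshoe n).sign = (-1) ^ n := by
  rw [← adjacentSwap_mul_outHorseshoe, Equiv.Perm.sign_mul, sign_outHorseshoe, mul_one,
    sign_adjacentSwap]

lemma Horse_le_alternatingGroup {n : ℕ} (hn : Even n) : Horse n ≤ alternatingGroup (Fin (2 * n)) := by
  refine (Subgroup.closure_le _).2 ?_
  rintro _ (rfl | rfl)
  · rw [SetLike.mem_coe, Equiv.Perm.mem_alternatingGroup, sign_inHorseshoe, hn.neg_one_pow]
  · rw [SetLike.mem_coe, Equiv.Perm.mem_alternatingGroup, sign_outHorseshoe]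

lemma Horse_eq_top {n : ℕ} (hn : Odd n) (h : alternatingGroup (Fin (2 * n)) ≤ Horse n) :
    Horse n = ⊤ := by
  rw [eq_top_iff]
  intro g _
  by_cases hg : g ∈ alternatingGroup (Fin (2 * n))
  · exact h hg
  · have h1 : g.sign = -1 := (Int.units_eq_one_or _).resolve_left
      fun e => hg (Equiv.Perm.mem_alternatingGroup.2 e)
    rw [← Subgroup.mul_mem_cancel_right _ (inHorseshoe_mem n)]
    apply h
    rw [Equiv.Perm.mem_alternatingGroup, Equiv.Perm.sign_mul, h1, sign_inHorseshoe, hn.neg_one_pow]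
    decide

/-! ### Monoid generation and reachable arrangements. -/

/-- In a finite group inverses are positive powers, so invariants need to be checked for products
only. -/
lemma mem_Horse_of_generators {n : ℕ} (S : Submonoid (Equiv.Perm (Fin (2 * n))))
    (hin : inHorseshoe n ∈ S) (hout : outHorseshoe n ∈ S) {g : Equiv.Perm (Fin (2 * n))}
    (hg : g ∈ Horse n) : g ∈ S := by
  rw [Horse, ← Subgroup.mem_toSubmonoid, Subgroup.closure_toSubmonoid_of_finite] at hg
  refine (Submonoid.closure_le.2 ?_) hg
  rintro _ (rfl | rfl)
  · exact hin
  · exact hout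

/-- The reachable arrangements are the elements of the shuffle group. -/
lemma setOf_horseArrangement (n : ℕ) :
    {d : Fin (2 * n) → Fin (2 * n) | HorseArrangement n d} =
      (fun g : Equiv.Perm (Fin (2 * n)) => ⇑g) '' Horse n := by
  ext d
  constructor
  · intro hd
    induction (show HorseArrangement n d from hd) with
    | start => exact ⟨1, one_mem _, rfl⟩
    | shuffle_in d h ih =>
      obtain ⟨g, hg, rfl⟩ := ih h
      exact ⟨g * (inHorseshoe n)⁻¹, mul_mem hg (inv_mem (inHorseshoe_mem n)), rfl⟩
    | shuffle_out d h ih =>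
      obtain ⟨g, hg, rfl⟩ := ih h
      exact ⟨g * (outHorseshoe n)⁻¹, mul_mem hg (inv_mem (outHorseshoe_mem n)), rfl⟩
  · rintro ⟨g, hg, rfl⟩
    -- An arrangement records the inverse of the shuffles performed, so the argument is applied to
    -- `g⁻¹`.
    let S : Submonoid (Equiv.Perm (Fin (2 * n))) :=
      { carrier := {g | ∀ d, HorseArrangement n d → HorseArrangement n (d ∘ ⇑g⁻¹)}
        one_mem' := fun d h => h
        mul_mem' := fun {a b} ha hb d h => by
          have := ha _ (hb d h)
          rwa [Function.comp_assoc, ← Equiv.Perm.coe_mul, ← mul_inv_rev] at this }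
    have h1 : g⁻¹ ∈ S := mem_Horse_of_generators S (fun d h => h.shuffle_in) (fun d h => h.shuffle_out)
      (inv_mem hg)
    have h2 := h1 id HorseArrangement.start
    rwa [inv_inv] at h2

lemma ncard_horseArrangement (n : ℕ) :
    {d : Fin (2 * n) → Fin (2 * n) | HorseArrangement n d}.ncard = Nat.card (Horse n) := by
  rw [setOf_horseArrangement, Set.ncard_image_of_injective _ DFunLike.coe_injective]
  exact (Nat.card_coe_set_eq _).symm

/-! ### Decks of a power of two: affine maps of bit vectors. -/

lemma xor_one_val (x : ℕ) : x ^^^ 1 = x / 2 * 2 + (1 - x % 2) := by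
  have h1 : (x ^^^ 1) / 2 = x / 2 := by rw [Nat.xor_div_two]; simp
  have h2 : (x ^^^ 1) % 2 = (x + 1) % 2 := Nat.xor_mod_two_eq
  omega

section powTwo

variable {n m : ℕ}

/-- The out shuffle is linear over the field of two elements: it is multiplication by t modulo 1 + t
+ … + t^(m+1), so it has order dividing m + 2. -/
lemma testBit_outHorseshoe (hn : n = 2 ^ m) (x : Fin (2 * n)) (j : ℕ) :
    (outHorseshoe n x : ℕ).testBit j = if j = 0 then (x : ℕ).testBit m else
      (decide (j ≤ m) && ((x : ℕ).testBit (j - 1) ^^ (x : ℕ).testBit m)) := by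
  have hx := x.isLt
  have hx' : (x : ℕ) < 2 ^ (m + 1) := by rw [pow_succ', ← hn]; exact hx
  rcases lt_or_ge (x : ℕ) n with h | h
  · rw [outHorseshoe_of_lt h]
    have hm : (x : ℕ).testBit m = false := Nat.testBit_lt_two_pow (h.trans_eq hn)
    rcases j with _ | j
    · simp [hm]
    · rw [hm]
      by_cases hj : j + 1 ≤ m
      · simp [Nat.testBit_succ, hj]
      · have : (x : ℕ).testBit j = false :=
          Nat.testBit_lt_two_pow
            (h.trans_le (hn.le.trans (Nat.pow_le_pow_right (by norm_num) (by omega))))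
        simp [Nat.testBit_succ, this]
  · rw [outHorseshoe_of_le h]
    have hm : (x : ℕ).testBit m = true := by
      rw [Nat.testBit_eq_decide_div_mod_eq, decide_eq_true_iff, ← hn,
        Nat.div_eq_of_lt_le (k := 1) (by omega) (by omega)]
    rcases j with _ | j
    · simp [hm]
    · rw [hm, Nat.testBit_succ, show (2 * (2 * n - 1 - (x : ℕ)) + 1) / 2 = 2 ^ (m + 1) - (x + 1) by
        rw [pow_succ', ← hn]; omega, Nat.testBit_two_pow_sub_succ hx']
      by_cases hj : j = m
      · subst hj; simp [hm]
      · simp only [Nat.add_eq_zero_iff, one_ne_zero, and_false, if_false, Nat.add_sub_cancel,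
          Bool.xor_true]
        congr 1
        simp only [decide_eq_decide]
        omega

/-- Addition of a fixed bit vector. -/
def xorPerm (hn : n = 2 ^ m) (c : Fin (2 * n)) : Equiv.Perm (Fin (2 * n)) :=
  Function.Involutive.toPerm
    (fun x => ⟨(x : ℕ) ^^^ c, by
      have h : 2 * n = 2 ^ (m + 1) := by rw [hn]; ring
      exact (Nat.xor_lt_two_pow (x.isLt.trans_eq h) (c.isLt.trans_eq h)).trans_eq h.symm⟩)
    (fun x => by ext; simp)

lemma xorPerm_val (hn : n = 2 ^ m) (c x : Fin (2 * n)) : (xorPerm hn c x : ℕ) = (x : ℕ) ^^^ c := rfl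

lemma xorPerm_mul (hn : n = 2 ^ m) (c d : Fin (2 * n)) :
    xorPerm hn c * xorPerm hn d = xorPerm hn (xorPerm hn c d) := by
  ext x
  rw [Equiv.Perm.mul_apply, xorPerm_val, xorPerm_val, xorPerm_val, xorPerm_val, Nat.xor_assoc]

lemma outHorseshoe_xorPerm (hn : n = 2 ^ m) (c x : Fin (2 * n)) :
    outHorseshoe n (xorPerm hn c x) = xorPerm hn (outHorseshoe n c) (outHorseshoe n x) := by
  ext
  rw [xorPerm_val]
  refine Nat.eq_of_testBit_eq fun j => ?_
  rw [Nat.testBit_xor]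
  simp only [testBit_outHorseshoe hn, xorPerm_val, Nat.testBit_xor]
  split_ifs
  · rfl
  · by_cases hj : j ≤ m
    · simp only [hj, decide_true, Bool.true_and]
      generalize (x : ℕ).testBit (j - 1) = a
      generalize (x : ℕ).testBit m = b
      generalize (c : ℕ).testBit (j - 1) = d
      generalize (c : ℕ).testBit m = e
      revert a b d e
      decide
    · simp [hj]

lemma outHorseshoe_pow_xorPerm (hn : n = 2 ^ m) (j : ℕ) (c x : Fin (2 * n)) :
    (outHorseshoe n ^ j) (xorPerm hn c x) =
      xorPerm hn ((outHorseshoe n ^ j) c) ((outHorseshoe n ^ j) x) := by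
  induction j with
  | zero => rfl
  | succ j ih => rw [pow_succ', Equiv.Perm.mul_apply, ih, outHorseshoe_xorPerm]; rfl

lemma outHorseshoe_pow_mul_xorPerm (hn : n = 2 ^ m) (j : ℕ) (c : Fin (2 * n)) :
    outHorseshoe n ^ j * xorPerm hn c =
      xorPerm hn ((outHorseshoe n ^ j) c) * outHorseshoe n ^ j := by
  ext1 x
  exact outHorseshoe_pow_xorPerm hn j c x

/-- An induction principle for bit vectors: every bit vector arises from zero by appending bits. -/
lemma bit_induction (hn : n = 2 ^ m) {P : Fin (2 * n) → Prop} (hpos : 0 < 2 * n)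
    (h0 : P ⟨0, hpos⟩) (hout : ∀ x, P x → P (outHorseshoe n x)) (h1 : ∀ x, P x → P (adjacentSwap n x))
    (x : Fin (2 * n)) : P x := by
  obtain ⟨x, hx⟩ := x
  induction x using Nat.strong_induction_on with
  | _ x ih =>
    rcases Nat.eq_zero_or_pos x with rfl | hp
    · exact h0
    have h2 := hout _ (ih (x / 2) (by omega) (by omega))
    have h3 : (outHorseshoe n ⟨x / 2, by omega⟩ : ℕ) = 2 * (x / 2) :=
      outHorseshoe_of_lt (by dsimp only; omega)
    rcases Nat.mod_two_eq_zero_or_one x with h | h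
    · have : outHorseshoe n ⟨x / 2, by omega⟩ = ⟨x, hx⟩ := Fin.ext (by rw [h3]; dsimp only; omega)
      rwa [this] at h2
    · have : adjacentSwap n (outHorseshoe n ⟨x / 2, by omega⟩) = ⟨x, hx⟩ :=
        Fin.ext (by rw [adjacentSwap_val, h3]; dsimp only; omega)
      exact this ▸ h1 _ h2

lemma adjacentSwap_eq_xorPerm (hn : n = 2 ^ m) (h1 : 1 < 2 * n) :
    adjacentSwap n = xorPerm hn ⟨1, h1⟩ := by
  ext x
  rw [adjacentSwap_val, xorPerm_val, xor_one_val]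

lemma outHorseshoe_zero (h0 : 0 < 2 * n) : outHorseshoe n ⟨0, h0⟩ = ⟨0, h0⟩ :=
  Fin.ext (by rw [outHorseshoe_of_lt (by dsimp only; omega), mul_zero])

lemma outHorseshoe_pow_zero (h0 : 0 < 2 * n) (j : ℕ) :
    (outHorseshoe n ^ j) ⟨0, h0⟩ = ⟨0, h0⟩ := by
  induction j with
  | zero => rfl
  | succ j ih => rw [pow_succ', Equiv.Perm.mul_apply, ih, outHorseshoe_zero]

lemma outHorseshoe_pow_one (hn : n = 2 ^ m) (h1 : 1 < 2 * n) {j : ℕ} (hj : j ≤ m) :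
    ((outHorseshoe n ^ j) ⟨1, h1⟩ : ℕ) = 2 ^ j := by
  induction j with
  | zero => rfl
  | succ j ih =>
    have h2 : 2 ^ j < n := by rw [hn]; exact Nat.pow_lt_pow_right (by norm_num) (by omega)
    rw [pow_succ', Equiv.Perm.mul_apply, outHorseshoe_of_lt (by rw [ih (by omega)]; exact h2),
      ih (by omega), pow_succ']

lemma outHorseshoe_pow_one_last (hn : n = 2 ^ m) (h1 : 1 < 2 * n) :
    ((outHorseshoe n ^ (m + 1)) ⟨1, h1⟩ : ℕ) = 2 * n - 1 := by
  have h := outHorseshoe_pow_one hn h1 le_rfl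
  rw [pow_succ', Equiv.Perm.mul_apply, outHorseshoe_of_le (by rw [h, hn]), h, ← hn]
  omega

lemma outHorseshoe_pow_eq_one (hn : n = 2 ^ m) (h1 : 1 < 2 * n) : outHorseshoe n ^ (m + 2) = 1 := by
  have hfix : (outHorseshoe n ^ (m + 2)) ⟨1, h1⟩ = ⟨1, h1⟩ := by
    have h := outHorseshoe_pow_one_last hn h1
    rw [Fin.ext_iff, pow_succ', Equiv.Perm.mul_apply, outHorseshoe_of_le (by rw [h]; omega), h]
    dsimp only
    omega
  ext1 x
  rw [Equiv.Perm.one_apply]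
  refine bit_induction hn (P := fun x => (outHorseshoe n ^ (m + 2)) x = x) (by omega)
    (outHorseshoe_pow_zero _ _) (fun x hx => ?_) (fun x hx => ?_) x
  · rw [← Equiv.Perm.mul_apply, ← pow_succ, pow_succ', Equiv.Perm.mul_apply, hx]
  · rw [adjacentSwap_eq_xorPerm hn h1, outHorseshoe_pow_xorPerm, hx, hfix]

lemma xorPerm_zero (hn : n = 2 ^ m) (h0 : 0 < 2 * n) : xorPerm hn ⟨0, h0⟩ = 1 := by
  ext x
  simp [xorPerm_val]

lemma xorPerm_mem_Horse (hn : n = 2 ^ m) (h1 : 1 < 2 * n) (c : Fin (2 * n)) :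
    xorPerm hn c ∈ Horse n := by
  have hadj : adjacentSwap n ∈ Horse n := by
    rw [← Subgroup.mul_mem_cancel_right _ (outHorseshoe_mem n), adjacentSwap_mul_outHorseshoe]
    exact inHorseshoe_mem n
  refine bit_induction hn (P := fun c => xorPerm hn c ∈ Horse n) (by omega) ?_
    (fun c hc => ?_) (fun c hc => ?_) c
  · rw [xorPerm_zero]; exact one_mem _
  · have := outHorseshoe_pow_mul_xorPerm hn 1 c
    rw [pow_one] at this
    rw [← Subgroup.mul_mem_cancel_right _ (outHorseshoe_mem n), ← this]
    exact mul_mem (outHorseshoe_mem n) hc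
  · rw [adjacentSwap_eq_xorPerm hn h1, ← xorPerm_mul, ← adjacentSwap_eq_xorPerm]
    exact mul_mem hadj hc

lemma exists_eq_of_mem_Horse (hn : n = 2 ^ m) (h1 : 1 < 2 * n) {g : Equiv.Perm (Fin (2 * n))}
    (hg : g ∈ Horse n) : ∃ c j, g = xorPerm hn c * outHorseshoe n ^ j := by
  let S : Submonoid (Equiv.Perm (Fin (2 * n))) :=
    { carrier := {g | ∃ c j, g = xorPerm hn c * outHorseshoe n ^ j}
      one_mem' := ⟨⟨0, by omega⟩, 0, by rw [xorPerm_zero]; rfl⟩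
      mul_mem' := by
        rintro _ _ ⟨c, i, rfl⟩ ⟨d, j, rfl⟩
        refine ⟨xorPerm hn c ((outHorseshoe n ^ i) d), i + j, ?_⟩
        rw [mul_assoc, ← mul_assoc _ (xorPerm hn d), outHorseshoe_pow_mul_xorPerm, ← xorPerm_mul,
          pow_add]
        simp only [mul_assoc] }
  refine mem_Horse_of_generators S ⟨⟨1, h1⟩, 1, ?_⟩ ⟨⟨0, by omega⟩, 1, ?_⟩ hg
  · rw [← adjacentSwap_eq_xorPerm, pow_one, adjacentSwap_mul_outHorseshoe]
  · rw [xorPerm_zero, pow_one, one_mul]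

/-- The order of the shuffle group of a deck of `2 ^ (m + 1)` cards. -/
theorem card_Horse_two_pow (hn : n = 2 ^ m) (hm : 0 < m) :
    Nat.card (Horse n) = (m + 2) * (2 * n) := by
  have h1 : 1 < 2 * n := by
    have : 0 < n := by rw [hn]; positivity
    omega
  have hinj : Function.Injective
      (fun p : Fin (m + 2) × Fin (2 * n) => xorPerm hn p.2 * outHorseshoe n ^ (p.1 : ℕ)) := by
    rintro ⟨i, c⟩ ⟨j, d⟩ h
    dsimp only at h
    have hcd : c = d := by
      have := congrArg (fun g : Equiv.Perm (Fin (2 * n)) => (g ⟨0, by omega⟩ : ℕ)) h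
      simp only [Equiv.Perm.mul_apply, outHorseshoe_pow_zero, xorPerm_val, Nat.zero_xor] at this
      exact Fin.ext this
    subst hcd
    have h' := congrArg (fun g : Equiv.Perm (Fin (2 * n)) => (g ⟨1, h1⟩ : ℕ)) (mul_left_cancel h)
    have key : ∀ i j : Fin (m + 2), ((outHorseshoe n ^ (i : ℕ)) ⟨1, h1⟩ : ℕ) =
        (outHorseshoe n ^ (j : ℕ)) ⟨1, h1⟩ → (i : ℕ) ≤ m → i = j := by
      intro i j h hi
      rw [outHorseshoe_pow_one hn h1 hi] at h
      by_cases hj : (j : ℕ) ≤ m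
      · rw [outHorseshoe_pow_one hn h1 hj] at h
        exact Fin.ext (Nat.pow_right_injective le_rfl h)
      · exfalso
        have hj' : (j : ℕ) = m + 1 := by omega
        rw [hj', outHorseshoe_pow_one_last hn h1] at h
        have h3 : 2 ^ (i : ℕ) ≤ 2 ^ m := Nat.pow_le_pow_right (by norm_num) hi
        -- Here `0 < m` is needed: with two cards the out shuffle is the identity.
        have h4 : 2 ^ 1 ≤ 2 ^ m := Nat.pow_le_pow_right (by norm_num) hm
        rw [← hn] at h3 h4
        omega
    by_cases hi : (i : ℕ) ≤ m
    · rw [key i j h' hi]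
    · by_cases hj : (j : ℕ) ≤ m
      · rw [key j i h'.symm hj]
      · rw [show i = j from Fin.ext (by omega)]
  have hrange : (Horse n : Set (Equiv.Perm (Fin (2 * n)))) = Set.range
      (fun p : Fin (m + 2) × Fin (2 * n) => xorPerm hn p.2 * outHorseshoe n ^ (p.1 : ℕ)) := by
    ext g
    constructor
    · intro hg
      obtain ⟨c, j, rfl⟩ := exists_eq_of_mem_Horse hn h1 hg
      refine ⟨⟨⟨j % (m + 2), Nat.mod_lt _ (by omega)⟩, c⟩, ?_⟩
      dsimp only
      conv_rhs => rw [← Nat.div_add_mod j (m + 2), pow_add, pow_mul, outHorseshoe_pow_eq_one hn h1,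
        one_pow, one_mul]
    · rintro ⟨p, rfl⟩
      exact mul_mem (xorPerm_mem_Horse hn h1 _) (pow_mem (outHorseshoe_mem n) _)
  rw [← SetLike.coe_sort_coe, hrange, Nat.card_range_of_injective hinj]
  simp

end powTwo

/-! ### Sharply transitive groups and shuffle words. -/

/-- The permutation given by a word in the in shuffle (`true`) and the out shuffle (`false`). -/
def shuffleWord (n : ℕ) (w : List Bool) : Equiv.Perm (Fin (2 * n)) :=
  (w.map fun b => if b then inHorseshoe n else outHorseshoe n).prod

lemma shuffleWord_mem (n : ℕ) (w : List Bool) : shuffleWord n w ∈ Horse n := by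
  refine list_prod_mem fun g hg => ?_
  obtain ⟨b, -, rfl⟩ := List.mem_map.1 hg
  cases b
  · exact outHorseshoe_mem n
  · exact inHorseshoe_mem n

/-- The order of a sharply `r`-transitive permutation group. -/
lemma card_of_sharply_transitive {N r : ℕ} (hr : r ≤ N) {G : Subgroup (Equiv.Perm (Fin N))}
    (htrans : ∀ k : Fin N, (k : ℕ) < r → ∀ x, k ≤ x → ∃ g ∈ G, (∀ i < k, g i = i) ∧ g k = x)
    (hstab : ∀ g ∈ G, (∀ i : Fin N, (i : ℕ) < r → g i = i) → g = 1) :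
    Nat.card G = N.descFactorial r := by
  let emb : G → (Fin r ↪ Fin N) := fun g => (Fin.castLEEmb hr).trans g.1.toEmbedding
  have h_emb : ∀ g i, emb g i = g.1 (Fin.castLE hr i) := fun _ _ => rfl
  have hinj : Function.Injective emb := by
    intro g h hgh
    have h1 : h⁻¹ * g = 1 := by
      refine Subtype.ext (hstab _ (h⁻¹ * g).2 fun i hi => ?_)
      have h2 := DFunLike.congr_fun hgh ⟨i, hi⟩
      rw [h_emb, h_emb] at h2
      change h.1⁻¹ (g.1 i) = i
      rw [Equiv.Perm.inv_eq_iff_eq]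
      exact h2
    exact (inv_mul_eq_one.1 h1).symm
  have hsurj : Function.Surjective emb := by
    intro f
    have key : ∀ k ≤ r, ∃ g ∈ G, ∀ i : Fin r, (i : ℕ) < k → g (Fin.castLE hr i) = f i := by
      intro k
      induction k with
      | zero => exact fun _ => ⟨1, one_mem _, fun i hi => absurd hi (Nat.not_lt_zero _)⟩
      | succ k ih =>
        intro hk
        obtain ⟨g, hg, hgf⟩ := ih (by omega)
        -- Pull the next target back through `g`; it is not before `k`, since `f` is injective, so
        -- the stabilizer of the earlier points can move `k` to it.
        obtain ⟨y, hy⟩ := g.surjective (f ⟨k, hk⟩)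
        have hky : (⟨k, by omega⟩ : Fin N) ≤ y := by
          by_contra hc
          rw [not_le, Fin.lt_def] at hc
          dsimp only at hc
          have h1 := hgf ⟨y, by omega⟩ hc
          have h2 : f ⟨y, by omega⟩ = f ⟨k, hk⟩ := by rw [← h1, ← hy]; rfl
          have h3 := congrArg Fin.val (f.injective h2)
          dsimp only at h3
          omega
        obtain ⟨u, hu, hfix, huk⟩ := htrans ⟨k, by omega⟩ hk y hky
        refine ⟨g * u, mul_mem hg hu, fun i hi => ?_⟩
        rw [Equiv.Perm.mul_apply]
        rcases Nat.lt_succ_iff_lt_or_eq.1 hi with h | h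
        · rw [hfix _ (Fin.lt_def.2 h), hgf i h]
        · obtain rfl : i = ⟨k, hk⟩ := Fin.ext h
          rw [show Fin.castLE hr ⟨k, hk⟩ = ⟨k, by omega⟩ from rfl, huk, hy]
    obtain ⟨g, hg, hgf⟩ := key r le_rfl
    exact ⟨⟨g, hg⟩, DFunLike.ext _ _ fun i => hgf i i.isLt⟩
  rw [Nat.card_eq_of_bijective emb ⟨hinj, hsurj⟩, Nat.card_eq_fintype_card,
    Fintype.card_embedding_eq, Fintype.card_fin, Fintype.card_fin]

/-- Two shuffle words that fix the positions before `k` and generate a group that moves `k` to all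
other positions. -/
def StabilizerWords (n : ℕ) (k : Fin (2 * n)) (v w : List Bool) : Prop :=
  (∀ i < k, shuffleWord n v i = i ∧ shuffleWord n w i = i) ∧
    ∀ x, k ≤ x → ∃ i j : Fin (2 * n), (shuffleWord n v ^ (i : ℕ) * shuffleWord n w ^ (j : ℕ)) k = x

instance (n : ℕ) (k : Fin (2 * n)) (v w : List Bool) : Decidable (StabilizerWords n k v w) :=
  inferInstanceAs (Decidable (_ ∧ _))

lemma StabilizerWords.exists_mem {n : ℕ} {k : Fin (2 * n)} {v w : List Bool}
    (h : StabilizerWords n k v w) (x : Fin (2 * n)) (hx : k ≤ x) :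
    ∃ g ∈ Horse n, (∀ i < k, g i = i) ∧ g k = x := by
  obtain ⟨i, j, hij⟩ := h.2 x hx
  refine ⟨_, mul_mem (pow_mem (shuffleWord_mem n v) i) (pow_mem (shuffleWord_mem n w) j),
    fun l hl => ?_, hij⟩
  have hpow : ∀ (g : Equiv.Perm (Fin (2 * n))), g l = l → ∀ k : ℕ, (g ^ k) l = l := by
    intro g hg k
    induction k with
    | zero => rfl
    | succ k ih => rw [pow_succ, Equiv.Perm.mul_apply, hg, ih]
  rw [Equiv.Perm.mul_apply, hpow _ (h.1 l hl).2, hpow _ (h.1 l hl).1]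

/-! ### Six cards: a group preserving a synthematic total. -/

section six

/-- A synthematic total: five fixed-point-free involutions of six points that together contain
every transposition once. -/
def total : List (List ℕ) :=
  [[1, 0, 5, 4, 3, 2], [5, 3, 4, 1, 2, 0], [2, 4, 0, 5, 1, 3], [3, 2, 1, 0, 5, 4],
    [4, 5, 3, 2, 0, 1]]

/-- The maps that preserve the synthematic total. -/
def PreservesTotal (g : Fin (2 * 3) → Fin (2 * 3)) : Prop :=
  ∀ s ∈ total, ∃ t ∈ total, ∀ x y, t.getD (g x) 0 = g y ↔ s.getD x 0 = y

instance (g : Fin (2 * 3) → Fin (2 * 3)) : Decidable (PreservesTotal g) :=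
  inferInstanceAs (Decidable (∀ s ∈ total, ∃ t ∈ total, ∀ x y, t.getD (g x) 0 = g y ↔ s.getD x 0 = y))

lemma preservesTotal_of_mem_Horse {g : Equiv.Perm (Fin (2 * 3))} (hg : g ∈ Horse 3) :
    PreservesTotal g := by
  let S : Submonoid (Equiv.Perm (Fin (2 * 3))) :=
    { carrier := {g | PreservesTotal g}
      one_mem' := fun s hs => ⟨s, hs, fun _ _ => Iff.rfl⟩
      mul_mem' := fun {a b} ha hb s hs => by
        obtain ⟨t, ht, h1⟩ := hb s hs
        obtain ⟨u, hu, h2⟩ := ha t ht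
        exact ⟨u, hu, fun x y => by rw [Equiv.Perm.mul_apply, Equiv.Perm.mul_apply, h2, h1]⟩ }
  exact mem_Horse_of_generators S (show PreservesTotal (inHorseshoe 3) by decide +kernel)
    (show PreservesTotal (outHorseshoe 3) by decide +kernel) hg

/-- This makes the pointwise stabilizer of three cards trivial. -/
lemma eq_of_preservesTotal : ∀ a b c : Fin (2 * 3), a ≠ b → b ≠ c → a ≠ c →
    PreservesTotal (fun x => [0, 1, 2, a, b, c].getD x 0) → a = 3 ∧ b = 4 ∧ c = 5 := by
  decide +kernel

theorem card_Horse_three : Nat.card (Horse 3) = 4 * 5 * 6 := by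
  rw [card_of_sharply_transitive (r := 3) (by norm_num)]
  · rfl
  · intro k hk
    obtain ⟨k, hk6⟩ := k
    dsimp only at hk
    interval_cases k
    · exact (show StabilizerWords 3 0 [] [true] by decide +kernel).exists_mem
    · exact (show StabilizerWords 3 1 [] [false] by decide +kernel).exists_mem
    · exact (show StabilizerWords 3 2 [] [true, true, false, true] by decide +kernel).exists_mem
  · intro g hg hfix
    have h1 := preservesTotal_of_mem_Horse hg
    have h0 : ⇑g = fun x : Fin (2 * 3) => [0, 1, 2, g 3, g 4, g 5].getD x 0 := by
      funext x
      fin_cases x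
      · exact hfix 0 (by decide)
      · exact hfix 1 (by decide)
      · exact hfix 2 (by decide)
      · rfl
      · rfl
      · rfl
    rw [h0] at h1
    obtain ⟨h3, h4, h5⟩ := eq_of_preservesTotal _ _ _ (g.injective.ne (by decide))
      (g.injective.ne (by decide)) (g.injective.ne (by decide)) h1
    rw [h3, h4, h5] at h0
    ext1 x
    rw [h0]
    revert x
    decide

end six

/-! ### Twelve cards: a group preserving a Steiner system. -/

section twelve

/-- Half of the hexads of a Steiner system `S(5, 6, 12)`, as sets of binary digits. -/
def halfHexads : List ℕ :=
  [126, 189, 219, 231, 315, 343, 365, 399, 438, 476, 490, 497, 567, 591, 633, 670, 683,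
    725, 748, 754, 797, 814, 858, 867, 884, 915, 933, 952, 966, 969, 1071, 1117, 1139,
    1175, 1210, 1230, 1257, 1268, 1310, 1333, 1355, 1382, 1400, 1433, 1443, 1452, 1477,
    1490, 1563, 1596, 1622, 1637, 1642, 1677, 1702, 1713, 1731, 1752, 1799, 1833, 1842,
    1868, 1873, 1930, 1940, 2016]

/-- The hexads of a Steiner system `S(5, 6, 12)`, as sets of binary digits. -/
def hexads : List ℕ := halfHexads ++ halfHexads.map (4095 - ·)

/-- The permutations that preserve the Steiner system. -/
def PreservesHexads (g : Equiv.Perm (Fin (2 * 6))) : Prop :=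
  ∀ m ∈ hexads, ∃ m' ∈ hexads, ∀ x, m'.testBit (g x) = m.testBit x

instance (g : Equiv.Perm (Fin (2 * 6))) : Decidable (PreservesHexads g) :=
  inferInstanceAs (Decidable (∀ m ∈ hexads, ∃ m' ∈ hexads, ∀ x, m'.testBit (g x) = m.testBit x))

lemma preservesHexads_of_mem_Horse {g : Equiv.Perm (Fin (2 * 6))} (hg : g ∈ Horse 6) :
    PreservesHexads g := by
  let S : Submonoid (Equiv.Perm (Fin (2 * 6))) :=
    { carrier := {g | PreservesHexads g}
      one_mem' := fun m hm => ⟨m, hm, fun _ => rfl⟩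
      mul_mem' := fun {a b} ha hb m hm => by
        obtain ⟨m', hm', h1⟩ := hb m hm
        obtain ⟨u, hu, h2⟩ := ha m' hm'
        exact ⟨u, hu, fun x => by rw [Equiv.Perm.mul_apply, h2, h1]⟩ }
  exact mem_Horse_of_generators S (show PreservesHexads (inHorseshoe 6) by decide +kernel)
    (show PreservesHexads (outHorseshoe 6) by decide +kernel) hg

/-- Some hexad contains all the given points. -/
def OnHexad (l : List (Fin (2 * 6))) : Prop := ∃ m ∈ hexads, ∀ x ∈ l, m.testBit x = true

instance (l : List (Fin (2 * 6))) : Decidable (OnHexad l) :=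
  inferInstanceAs (Decidable (∃ m ∈ hexads, ∀ x ∈ l, m.testBit x = true))

lemma PreservesHexads.onHexad_map {g : Equiv.Perm (Fin (2 * 6))} (h : PreservesHexads g)
    {l : List (Fin (2 * 6))} (hl : OnHexad l) : OnHexad (l.map g) := by
  obtain ⟨m, hm, h1⟩ := hl
  obtain ⟨m', hm', h2⟩ := h m hm
  refine ⟨m', hm', fun x hx => ?_⟩
  obtain ⟨y, hy, rfl⟩ := List.mem_map.1 hx
  rw [h2, h1 y hy]

lemma eq_eleven_of_onHexad : ∀ x : Fin (2 * 6), 5 ≤ x → OnHexad [0, 1, 2, 3, 4, x] → x = 11 := by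
  decide +kernel

-- Once 0, …, 4 and 11 are fixed, hexads through four of 0, …, 4 link the remaining points in pairs.
-- The variables follow the path 5, 10, 7, 8, 6, 9 of such links, and the extra hexads settle the
-- choices left. Inequalities between neighbours exclude repeated points, which `OnHexad` admits;
-- staging the hypotheses keeps the search small.
set_option synthInstance.maxHeartbeats 400000 in
set_option synthInstance.maxSize 1000 in
lemma eq_of_onHexad : ∀ a : Fin (2 * 6), 5 ≤ a ∧ a ≠ 11 →
    ∀ b, 5 ≤ b ∧ b ≠ 11 ∧ b ≠ a ∧ OnHexad [0, 1, 2, 3, a, b] →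
    ∀ c, 5 ≤ c ∧ c ≠ 11 ∧ c ≠ b ∧ OnHexad [0, 1, 2, 4, b, c] ∧ OnHexad [0, 2, 3, 4, a, c] →
    ∀ d, 5 ≤ d ∧ d ≠ 11 ∧ d ≠ c ∧ OnHexad [0, 1, 2, 3, c, d] ∧ OnHexad [0, 1, 3, 4, a, d] →
    ∀ e, 5 ≤ e ∧ e ≠ 11 ∧ e ≠ d ∧ OnHexad [0, 1, 2, 4, d, e] ∧ OnHexad [0, 1, 3, 4, c, e] →
    ∀ f, 5 ≤ f ∧ f ≠ 11 ∧ f ≠ e ∧ OnHexad [0, 1, 2, 3, e, f] ∧ OnHexad [0, 1, 3, 4, b, f] →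
    a = 5 ∧ b = 10 ∧ c = 7 ∧ d = 8 ∧ e = 6 ∧ f = 9 := by
  decide +kernel

theorem card_Horse_six : Nat.card (Horse 6) = 8 * 9 * 10 * 11 * 12 := by
  rw [card_of_sharply_transitive (r := 5) (by norm_num)]
  · rfl
  · intro k hk
    obtain ⟨k, hk12⟩ := k
    dsimp only at hk
    interval_cases k
    · exact (show StabilizerWords 6 0 [false] [true] by decide +kernel).exists_mem
    · exact (show StabilizerWords 6 1 [] [false] by decide +kernel).exists_mem
    · exact (show StabilizerWords 6 2
        [false, true, false, false, true, true]
        [true, true, true, false, true, false, false] by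
        decide +kernel).exists_mem
    · exact (show StabilizerWords 6 3
        [false, true, true, true, false, true, false]
        [false, true, false, false, false, true, false, false, true, false, true, true] by
        decide +kernel).exists_mem
    · exact (show StabilizerWords 6 4
        [true, false, false, false, false, true, false, true, false, false, false]
        [true, false, true, true, true, false, true, true, false, false, false, false, true, true, false, true, false] by
        decide +kernel).exists_mem
  · intro g hg hfix
    have hp := preservesHexads_of_mem_Horse hg
    have h0 : g 0 = 0 := hfix 0 (by decide)
    have h1 : g 1 = 1 := hfix 1 (by decide)
    have h2 : g 2 = 2 := hfix 2 (by decide)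
    have h3 : g 3 = 3 := hfix 3 (by decide)
    have h4 : g 4 = 4 := hfix 4 (by decide)
    have hge : ∀ x : Fin (2 * 6), 5 ≤ x → 5 ≤ g x := by
      intro x hx
      by_contra hc
      rw [not_le, Fin.lt_def] at hc
      have h5 := g.injective (hfix (g x) hc)
      rw [h5] at hc
      exact absurd hx (not_le.2 (Fin.lt_def.2 hc))
    have hmap : ∀ a b c d e f : Fin (2 * 6), OnHexad [a, b, c, d, e, f] →
        OnHexad [g a, g b, g c, g d, g e, g f] := fun a b c d e f h => hp.onHexad_map h
    have h11 : g 11 = 11 := by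
      have := hmap 0 1 2 3 4 11 (by decide +kernel)
      rw [h0, h1, h2, h3, h4] at this
      exact eq_eleven_of_onHexad _ (hge _ (by decide)) this
    have hne : ∀ x : Fin (2 * 6), x ≠ 11 → g x ≠ 11 := fun x hx e =>
      hx (g.injective (e.trans h11.symm))
    have e1 := hmap 0 1 2 3 5 10 (by decide +kernel)
    have e2 := hmap 0 1 2 4 10 7 (by decide +kernel)
    have e3 := hmap 0 2 3 4 5 7 (by decide +kernel)
    have e4 := hmap 0 1 2 3 7 8 (by decide +kernel)
    have e5 := hmap 0 1 3 4 5 8 (by decide +kernel)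
    have e6 := hmap 0 1 2 4 8 6 (by decide +kernel)
    have e7 := hmap 0 1 3 4 7 6 (by decide +kernel)
    have e8 := hmap 0 1 2 3 6 9 (by decide +kernel)
    have e9 := hmap 0 1 3 4 10 9 (by decide +kernel)
    simp only [h0, h1, h2, h3, h4] at e1 e2 e3 e4 e5 e6 e7 e8 e9
    have hni : ∀ {x y : Fin (2 * 6)}, x ≠ y → g x ≠ g y := g.injective.ne
    obtain ⟨k5, k10, k7, k8, k6, k9⟩ := eq_of_onHexad (g 5) ⟨hge _ (by decide), hne _ (by decide)⟩
      (g 10) ⟨hge _ (by decide), hne _ (by decide), hni (by decide), e1⟩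
      (g 7) ⟨hge _ (by decide), hne _ (by decide), hni (by decide), e2, e3⟩
      (g 8) ⟨hge _ (by decide), hne _ (by decide), hni (by decide), e4, e5⟩
      (g 6) ⟨hge _ (by decide), hne _ (by decide), hni (by decide), e6, e7⟩
      (g 9) ⟨hge _ (by decide), hne _ (by decide), hni (by decide), e8, e9⟩
    ext1 x
    rw [Equiv.Perm.one_apply]
    fin_cases x
    exacts [h0, h1, h2, h3, h4, k5, k6, k7, k8, k9, k10, h11]

end twelve

/-! ### The orders of the shuffle groups. -/

lemma alternatingGroup_le_Horse {M : ℕ} (hM : Odd M) (hM3 : 3 ≤ M) (a : ℕ) (h : M = 3 → 2 ≤ a) :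
    alternatingGroup (Fin (2 * (2 ^ a * M))) ≤ Horse (2 ^ a * M) :=
  (alternatingGroup_le_shuffledSwapGroup hM hM3 a h).trans (shuffledSwapGroup_le_Horse hM rfl)

theorem card_Horse_of_odd {n : ℕ} (hn : Odd n) (h3 : n ≠ 3) : Nat.card (Horse n) = (2 * n)! := by
  have hA : alternatingGroup (Fin (2 * n)) ≤ Horse n := by
    by_cases h1 : n = 1
    · subst h1
      -- Two cards: the alternating group is trivial, and the sign of the in shuffle does the rest.
      rw [alternatingGroup.eq_bot_of_card_le_two (by simp)]
      exact bot_le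
    · have hn2 := Nat.odd_iff.1 hn
      have := alternatingGroup_le_Horse hn (by omega) 0 (fun e => absurd e h3)
      rwa [pow_zero, one_mul] at this
  rw [Horse_eq_top hn hA, Subgroup.card_top, Nat.card_perm, Nat.card_fin]

theorem card_Horse_of_even {n : ℕ} (h0 : 0 < n) (hn : Even n) (h6 : n ≠ 6)
    (hpow : ∀ k : ℕ, n ≠ 2 ^ k) : Nat.card (Horse n) = (2 * n)! / 2 := by
  obtain ⟨a, M, hM, rfl⟩ := Nat.exists_eq_two_pow_mul_odd h0.ne'
  have hM1 : M ≠ 1 := fun e => hpow a (by rw [e, mul_one])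
  have hM2 := Nat.odd_iff.1 hM
  have hA := alternatingGroup_le_Horse hM (by omega) a (fun e => by
    subst e
    by_contra hc
    have : a = 0 ∨ a = 1 := by omega
    rcases this with rfl | rfl
    · exact absurd hn (by decide)
    · exact h6 (by norm_num))
  rw [le_antisymm (Horse_le_alternatingGroup hn) hA]
  have : Nontrivial (Fin (2 * (2 ^ a * M))) := Fin.nontrivial_iff_two_le.2 (by omega)
  rw [nat_card_alternatingGroup, Nat.card_fin]

theorem theorem3 (n : ℕ) (hn : 0 < n) :
    (2 * n = 6 → Nat.card (Horse n) = 4 * 5 * 6) ∧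
    (2 * n = 12 → Nat.card (Horse n) = 8 * 9 * 10 * 11 * 12) ∧
    (∀ k : ℕ, 2 ≤ k → 2 * n = 2 ^ k → Nat.card (Horse n) = (k + 1) * 2 ^ k) ∧
    (Odd n → n ≠ 3 → Nat.card (Horse n) = (2 * n)!) ∧
    (Even n → n ≠ 6 → (∀ k : ℕ, n ≠ 2 ^ k) → Nat.card (Horse n) = (2 * n)! / 2) ∧
    {d : Fin (2 * n) → Fin (2 * n) | HorseArrangement n d}.ncard = Nat.card (Horse n) := by
  refine ⟨fun h => ?_, fun h => ?_, fun k hk h => ?_, card_Horse_of_odd,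
    card_Horse_of_even hn, ncard_horseArrangement n⟩
  · obtain rfl : n = 3 := by omega
    exact card_Horse_three
  · obtain rfl : n = 6 := by omega
    exact card_Horse_six
  · obtain ⟨m, rfl⟩ : ∃ m, k = m + 1 := ⟨k - 1, by omega⟩
    have hm : n = 2 ^ m := by
      rw [pow_succ'] at h
      omega
    rw [card_Horse_two_pow hm (by omega), h]
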